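/- Let $V$ be a finite-dimensional real inner product space and let $\Phi\subseteq V$ be an irreducible (reduced, crystallographic) root system spanning $V$. Write $\alpha^\vee = 2\alpha/\langle\alpha,\alpha\rangle$ for $\alpha \in \Phi$. Fix simple roots $\alpha_1,\dots,\alpha_n$, and let $\Phi^+$ be the corresponding positive roots, $W$ the Weyl group, $s_i$ the reflection in $\alpha_i$, $\ell$ the length function of $W$ with respect to $s_1,\dots,s_n$, $Q=\mathrm{Span}_{\mathbb Z}\Phi$ the root lattice, $P=\{v\in V: \langle v,\alpha^\vee\rangle\in\mathbb Z \text{ for all } \alpha\in\Phi\}$ the weight lattice, $\omega_1,\dots,\omega_n$ the fundamental weights (the dual basis to $\alpha_1^\vee,\dots,\alpha_n^\vee$), and $P_{\ge 0}=\{v\in P:\langle v,\alpha_i^\vee\rangle\ge 0 \text{ for all } i\}$ the dominant weights. For $\lambda\in P$ let $w_\lambda$ be the element of minimal length in $\{w\in W: w^{-1}(\lambda)\in P_{\ge 0}\}$, let $\lambda_{\mathrm{dom}}=w_\lambda^{-1}(\lambda)$ be the dominant element of $W(\lambda)$, and let $I^{0,1}_\lambda=\{i: \langle\lambda_{\mathrm{dom}},\alpha_i^\vee\rangle\in\{0,1\}\}$.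 Let $\mathbf k:\Phi\to\mathbb Z_{\ge 0}$ be $W$-invariant. Put $\rho_{\mathbf k}=\sum_i \mathbf k(\alpha_i)\omega_i$ and $\eta_{\mathbf k}(\lambda)=\lambda+w_\lambda(\rho_{\mathbf k})$ for $\lambda \in P$. The symmetric interval-firing process is the relation on $P$ with moves $\mu\to\mu+\alpha$ for $\mu\in P$ and $\alpha\in\Phi^+$ such that $\langle\mu+\tfrac{\alpha}{2},\alpha^\vee\rangle\in[-\mathbf k(\alpha),\mathbf k(\alpha)]$; let $\Gamma_{\mathrm{sym},\mathbf k}$ be the corresponding directed graph on $P$. The function $\mathbf k$ is called good if either $\Phi$ is simply laced, or $\Phi$ is not simply laced and ($\mathbf k=0$ on short roots implies $\mathbf k=0$ on long roots). For $v\in P$ and $I\subseteq\{1,\dots,n\}$ let $W_I=\langle s_i: i\in I\rangle$, $\Pi^Q(v)=\mathrm{ConvexHull}(W(v))\cap(Q+v)$ and $\Pi^Q_I(v)=\mathrm{ConvexHull}(W_I(v))\cap(Q+v)$. Suppose that $\mathbf k$ is good. Then: 1. For every $\lambda\in P_{\ge 0}$, the underlying undirected graph of $\Gamma_{\mathrm{sym},\mathbf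 k}$ has no edge joining a vertex in $\Pi^Q(\eta_{\mathbf k}(\lambda))$ to a vertex not in $\Pi^Q(\eta_{\mathbf k}(\lambda))$; that is, no symmetric firing move leaves or enters this discrete permutohedron. 2. For every $\lambda\in P$ with $\langle\lambda,\alpha^\vee\rangle\neq -1$ for all $\alpha\in\Phi^+$, the weight $\eta_{\mathbf k}(\lambda)$ is a sink of $\Gamma_{\mathrm{sym},\mathbf k}$ (no firing move starts at it), and the connected component of $\eta_{\mathbf k}(\lambda)$ in the underlying undirected graph of $\Gamma_{\mathrm{sym},\mathbf k}$ is contained in $w_\lambda\,\Pi^Q_{I^{0,1}_\lambda}(\eta_{\mathbf k}(\lambda_{\mathrm{dom}}))$. -/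

import Mathlib

open scoped Pointwise

noncomputable section

namespace IntervalFiring

variable {ι M N : Type*} [AddCommGroup M] [Module ℝ M] [AddCommGroup N] [Module ℝ N]

/-! ### Lattices, lengths of roots, Weyl-invariant functions -/

/-- The weight lattice: the vectors `v` with `⟨v, α^∨⟩ ∈ ℤ` for every root `α`. -/
def weightLattice (P : RootPairing ι ℝ M N) : AddSubgroup M where
  carrier := {v | ∀ i, ∃ n : ℤ, P.coroot' i v = n}
  zero_mem' := fun i => ⟨0, by simp⟩
  add_mem' := by
    intro v w hv hw i
    obtain ⟨m, hm⟩ := hv i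
    obtain ⟨n, hn⟩ := hw i
    exact ⟨m + n, by rw [map_add, hm, hn]; push_cast; rfl⟩
  neg_mem' := by
    intro v hv i
    obtain ⟨m, hm⟩ := hv i
    exact ⟨-m, by rw [map_neg, hm]; push_cast; rfl⟩

/-- A function on the roots is `W`-invariant. -/
def IsWeylInvariant (P : RootPairing ι ℝ M N) (k : ι → ℕ) : Prop :=
  ∀ (w : P.weylGroup) (i : ι), k (w • i) = k i

/-- A root is long if no root has greater length. Lengths are measured in the canonical
`W`-invariant inner product `(x, y) ↦ ∑ α, ⟨x, α^∨⟩ ⟨y, α^∨⟩`; for an irreducible root system every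
`W`-invariant inner product is a positive multiple of it. -/
def IsLong [Fintype ι] (P : RootPairing ι ℝ M N) (i : ι) : Prop :=
  ∀ j, P.RootForm (P.root j) (P.root j) ≤ P.RootForm (P.root i) (P.root i)

/-- A root is short if it is not long. -/
def IsShort [Fintype ι] (P : RootPairing ι ℝ M N) (i : ι) : Prop :=
  ¬ IsLong P i

/-- There is no arrow in the Dynkin diagram. -/
def IsSimplyLaced {P : RootPairing ι ℝ M N} (b : P.Base) : Prop :=
  ∀ i ∈ b.support, ∀ j ∈ b.support, i ≠ j →
    P.pairing i j * P.pairing j i = 0 ∨ P.pairing i j * P.pairing j i = 1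

/-- Goodness: no condition in the simply laced case; otherwise `k_s = 0` implies `k_l = 0`. -/
def IsGood [Fintype ι] {P : RootPairing ι ℝ M N} (b : P.Base) (k : ι → ℕ) : Prop :=
  ¬ IsSimplyLaced b → (∀ i, IsShort P i → k i = 0) → ∀ i, IsLong P i → k i = 0

/-! ### Symmetric interval-firing -/

/-- One move of the symmetric interval-firing process: `μ → μ + α` for a weight `μ` and a positive
root `α` with `⟨μ + α/2, α^∨⟩ ∈ [-k(α), k(α)]`. -/
def SymFire {P : RootPairing ι ℝ M N} (b : P.Base) (k : ι → ℕ) (μ μ' : M) : Prop :=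
  μ ∈ weightLattice P ∧ ∃ i, b.IsPos i ∧ μ' = μ + P.root i ∧
    P.coroot' i (μ + (1 / 2 : ℝ) • P.root i) ∈ Set.Icc (-(k i : ℝ)) (k i)

/-- The connected component of `ν` in the digraph of symmetric interval-firing on the weight
lattice (that is, in its underlying undirected graph). -/
def component {P : RootPairing ι ℝ M N} (b : P.Base) (k : ι → ℕ) (ν : M) : Set M :=
  {μ | μ ∈ weightLattice P ∧ Relation.EqvGen (SymFire b k) μ ν}

/-! ### The Weyl group: lengths, parabolic subgroups, dominant representatives -/

/-- The length of `w`: the least length of a word in the simple reflections with product `w`. -/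
def length {P : RootPairing ι ℝ M N} (b : P.Base) (w : P.weylGroup) : ℕ :=
  sInf {n | ∃ l : List b.support,
    l.length = n ∧ (l.map fun i => RootPairing.weylGroup.ofIdx P (i : ι)).prod = w}

/-- The parabolic subgroup generated by the simple reflections `s_i` with `i ∈ I`. -/
def parabolic (P : RootPairing ι ℝ M N) (I : Set ι) : Subgroup P.weylGroup :=
  Subgroup.closure (RootPairing.weylGroup.ofIdx P '' I)

/-- The closed fundamental chamber: `⟨v, α_i^∨⟩ ≥ 0` for every simple root `α_i`. -/
def dominantCone {P : RootPairing ι ℝ M N} (b : P.Base) : Set M :=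
  {v | ∀ i ∈ b.support, 0 ≤ P.coroot' i v}

/-- Dominant weights. -/
def dominantWeights {P : RootPairing ι ℝ M N} (b : P.Base) : Set M :=
  {v | v ∈ weightLattice P ∧ v ∈ dominantCone b}

lemma ofIdx_smul_eq (P : RootPairing ι ℝ M N) (i : ι) (v : M) :
    RootPairing.weylGroup.ofIdx P i • v = v - P.coroot' i v • P.root i := by
  rw [RootPairing.weylGroup.ofIdx_smul, RootPairing.Equiv.reflection_smul,
    RootPairing.reflection_apply]

/-- The Weyl group of a finite root system is finite. -/
lemma finite_weylGroup [Finite ι] (P : RootPairing ι ℝ M N) [P.IsRootSystem] :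
    Finite P.weylGroup := by
  refine Finite.of_injective (fun w : P.weylGroup => P.weylGroupToPerm w) ?_
  intro w w' h
  have hroot : ∀ i, w • P.root i = w' • P.root i := by
    intro i
    rw [P.weylGroup_apply_root, P.weylGroup_apply_root]
    exact congrArg P.root (congrArg (fun e : Equiv.Perm ι => e i) h)
  apply Subtype.ext
  apply RootPairing.Equiv.weightHom_injective P
  apply LinearEquiv.toLinearMap_injective
  refine LinearMap.ext_on_range (v := P.root) RootPairing.IsRootSystem.span_root_eq_top ?_
  exact hroot

/-- Every Weyl group orbit meets the closed fundamental chamber. -/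
lemma exists_dominant [Finite ι] {P : RootPairing ι ℝ M N} [P.IsRootSystem] (b : P.Base) (v : M) :
    {w : P.weylGroup | w⁻¹ • v ∈ dominantCone b}.Nonempty := by
  have := finite_weylGroup P
  let g : M →ₗ[ℝ] ℝ := b.toWeightBasis.constr ℝ (fun _ => (1 : ℝ))
  have hg : ∀ i ∈ b.support, g (P.root i) = 1 := by
    intro i hi
    have := b.toWeightBasis.constr_basis ℝ (fun _ => (1 : ℝ)) ⟨i, hi⟩
    rwa [b.toWeightBasis_apply] at this
  obtain ⟨w, hw⟩ := Finite.exists_max (fun w : P.weylGroup => g (w⁻¹ • v))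
  refine ⟨w, fun i hi => ?_⟩
  have h := hw (w * (RootPairing.weylGroup.ofIdx P i)⁻¹)
  rw [mul_inv_rev, inv_inv, mul_smul, ofIdx_smul_eq, map_sub, LinearMap.map_smul, hg i hi,
    smul_eq_mul, mul_one] at h
  linarith

/-- `w_v`: the element of minimal length among the `w` for which `w⁻¹ v` is dominant. -/
def minElt [Finite ι] {P : RootPairing ι ℝ M N} [P.IsRootSystem] (b : P.Base) (v : M) :
    P.weylGroup :=
  Function.argminOn (length b) {w : P.weylGroup | w⁻¹ • v ∈ dominantCone b} (exists_dominant b v)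

/-- `v_dom`: the dominant element `w_v⁻¹ v` of the Weyl group orbit of `v`. -/
def dom [Finite ι] {P : RootPairing ι ℝ M N} [P.IsRootSystem] (b : P.Base) (v : M) : M :=
  (minElt b v)⁻¹ • v

/-! ### Fundamental weights and the map `η` -/

/-- The fundamental weights: the basis of `M` dual to the basis of simple coroots. -/
def fundamentalWeight {P : RootPairing ι ℝ M N} [P.IsRootSystem] (b : P.Base) (i : b.support) : M :=
  P.toLinearMap.toPerfPair.symm (b.toCoweightBasis.coord i)

open scoped Classical in
lemma coroot'_fundamentalWeight {P : RootPairing ι ℝ M N} [P.IsRootSystem] (b : P.Base)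
    (i j : b.support) :
    P.coroot' (j : ι) (fundamentalWeight b i) = if j = i then 1 else 0 := by
  have h : P.coroot' (j : ι) (fundamentalWeight b i) = b.toCoweightBasis.coord i (P.coroot j) := by
    change P.toLinearMap (fundamentalWeight b i) (P.coroot j) = _
    rw [fundamentalWeight, LinearMap.apply_symm_toPerfPair_self]
  rw [h, Module.Basis.coord_apply, b.toCoweightBasis_repr_coroot, Finsupp.single_apply]

/-- `ρ_k = ∑ k(α_i) ω_i`. -/
def rhoK {P : RootPairing ι ℝ M N} [P.IsRootSystem] (b : P.Base) (k : ι → ℕ) : M :=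
  ∑ i : b.support, (k i : ℝ) • fundamentalWeight b i

/-- `η_k(v) = v + w_v(ρ_k)`. -/
def eta [Finite ι] {P : RootPairing ι ℝ M N} [P.IsRootSystem] (b : P.Base) (k : ι → ℕ) (v : M) :
    M :=
  v + minElt b v • rhoK b k

/-- The set `I^{0,1}_v` of indices `i` for which the coefficient `c_i = ⟨v_dom, α_i^∨⟩` of `ω_i`
in `v_dom` is `0` or `1`. -/
def zeroOneSet [Finite ι] {P : RootPairing ι ℝ M N} [P.IsRootSystem] (b : P.Base) (v : M) :
    Set ι :=
  {i | i ∈ b.support ∧ (P.coroot' i (dom b v) = 0 ∨ P.coroot' i (dom b v) = 1)}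

/-! ### Permutohedra -/

/-- The permutohedron `Π(v)`, the convex hull of the Weyl group orbit. -/
def permutohedron (P : RootPairing ι ℝ M N) (v : M) : Set M :=
  convexHull ℝ (MulAction.orbit P.weylGroup v)

/-- The discrete permutohedron `Π^Q(v) = Π(v) ∩ (Q + v)`, where `Q` is the root lattice. -/
def discretePermutohedron (P : RootPairing ι ℝ M N) (v : M) : Set M :=
  {x | x ∈ permutohedron P v ∧ x - v ∈ P.rootSpan ℤ}

/-- The parabolic permutohedron `Π_I(v)`, the convex hull of the orbit under `W_I`. -/
def parabolicPermutohedron (P : RootPairing ι ℝ M N) (I : Set ι) (v : M) : Set M :=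
  convexHull ℝ (MulAction.orbit (parabolic P I) v)

/-- The discrete parabolic permutohedron `Π_I^Q(v) = Π_I(v) ∩ (Q + v)`. -/
def discreteParabolicPermutohedron (P : RootPairing ι ℝ M N) (I : Set ι) (v : M) : Set M :=
  {x | x ∈ parabolicPermutohedron P I v ∧ x - v ∈ P.rootSpan ℤ}

end IntervalFiring

end

/-!
The theorem is a statement about how far a discrete permutohedron reaches in the direction of a
root. Write `x ≤ y` if `y - x` is a nonnegative combination of simple roots. For dominant `v` the
permutohedron of `v` consists of the `x` all of whose Weyl conjugates are `≤ v`
(`permutohedron_eq_saturation`).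

The heart of the matter is `add_root_mem_saturation`: let `k` be good and let `v` be a weight with
`⟨v, α_j^∨⟩ ≥ k(α_j)` for all simple roots `α_j`; if `μ` lies in the discrete permutohedron of `v`
and `⟨μ, α^∨⟩ < k(α)`, then so does `μ + α`. If `⟨μ, α^∨⟩ < 0` this is convexity. Otherwise move
`μ` into the dominant chamber and, within the stabilizer of `μ`, move `α` as high as possible;
then `α` is positive.

* `coef_root_le_coef_sub` shows `μ + α ≤ v`. The conjugates `β ≤ α` of `α` are reached from a
  simple root by reflections in simple roots, and one proves `β ≤ γ := v - μ` along the way.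
  Suppose that the step from `β₀ = s_j β` to `β` fails, so that `γ - β₀` has too small a
  coefficient at `α_j`. If `α_j` is conjugate to `α`, this bounds `⟨γ, α_j^∨⟩` from above by `-1`,
  while the hypotheses on `v` and `μ` bound it from below by `1`. If not, the same comparison is
  made with a conjugate `y ≤ α` of least height with `α_j` in its support, for which `⟨y, α_l^∨⟩ ≤
  0` when `l ≠ j`. The two bounds for `⟨γ, y^∨⟩` are compatible only if `α` is longer than `α_j`
  and `k(α_j) = 0 < k(α)`, which goodness forbids.
* `add_root_mem_saturation_of_le` passes from `μ + α ≤ v` to the same inequality for the dominant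
  conjugate of `μ + α`. For a shortest root `α`, reflecting in a simple root with negative
  coordinate adds just this simple root and gives another vector of the form `μ + β`, with `β` a
  shortest root. A longer root becomes a shortest one after the first such reflection.

A firing move out of the permutohedron of `η_k(v)`, in either direction, would contradict this
lemma. That `η_k(v)` is a sink comes from a direct computation with its coordinates, in which the
minimality of `w_v` excludes the positive roots that `w_v⁻¹` makes negative and orthogonal to
`v_dom`. For the connected components, translate by `w_v`, so that the component starts at
`η_k(v_dom)`. Moves along roots of the parabolic subsystem of `I^{0,1}` do not leave the
permutohedron, and therefore not its face, the parabolic permutohedron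
(`mem_parabolicPermutohedron`). For the other positive roots `⟨v_dom, α^∨⟩ ≥ 2`, so that `⟨·, α^∨⟩
≥ k(α) + 2` on this face and there are no moves (`le_coroot'_of_mem_parabolicPermutohedron`).
-/

set_option linter.unusedSectionVars false

noncomputable section

namespace IntervalFiring
open RootPairing
variable {ι M N : Type*} [AddCommGroup M] [Module ℝ M] [AddCommGroup N] [Module ℝ N]

/-! ### The invariant form and the Weyl group action -/

section Form
variable [Fintype ι] (P : RootPairing ι ℝ M N)

/-- The identity `⟨x, α^∨⟩ = 2⟨x, α⟩ / ⟨α, α⟩`, cleared of its denominator. -/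
lemma two_mul_rootForm (i : ι) (x : M) :
    2 * P.RootForm x (P.root i) = P.coroot' i x * P.RootForm (P.root i) (P.root i) := by
  have h := congrArg (P.toLinearMap x) (P.rootForm_self_smul_coroot i)
  have h2 : P.toLinearMap x (P.Polarization (P.root i)) = P.RootForm (P.root i) x :=
    P.toLinearMap_apply_apply_Polarization _ _
  rw [map_smul, map_nsmul, h2, smul_eq_mul, nsmul_eq_mul, Nat.cast_ofNat,
    show P.RootForm (P.root i) x = P.RootForm x (P.root i) from P.rootForm_symmetric.eq _ _] at h
  rw [← h, mul_comm]
  rfl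

lemma rootForm_comm (x y : M) : P.RootForm x y = P.RootForm y x :=
  P.rootForm_symmetric.eq _ _

lemma rootForm_root_pos (i : ι) : 0 < P.RootForm (P.root i) (P.root i) :=
  P.rootForm_pos_of_ne_zero (Submodule.subset_span ⟨i, rfl⟩) (P.ne_zero i)

lemma root_smul (w : P.weylGroup) (i : ι) : P.root (w • i) = w • P.root i :=
  (P.weylGroup_apply_root w i).symm

lemma root_reflection_smul (i j : ι) :
    P.root (weylGroup.ofIdx P i • j) = P.root j - P.pairing j i • P.root i := by
  rw [root_smul, ofIdx_smul_eq, P.root_coroot'_eq_pairing]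

lemma root_reflection_smul_self (i : ι) : P.root (weylGroup.ofIdx P i • i) = -P.root i := by
  rw [root_reflection_smul, P.pairing_same, two_smul]
  abel

lemma rootForm_smul_smul (w : P.weylGroup) (x y : M) :
    P.RootForm (w • x) (w • y) = P.RootForm x y :=
  RootPairing.InvariantForm.apply_weylGroup_smul P (B := P.toInvariantForm) w x y

lemma rootForm_smul_left (w : P.weylGroup) (x y : M) :
    P.RootForm (w • x) y = P.RootForm x (w⁻¹ • y) := by
  rw [← rootForm_smul_smul P w x (w⁻¹ • y), smul_inv_smul]

lemma rootForm_root_smul (w : P.weylGroup) (i : ι) :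
    P.RootForm (P.root (w • i)) (P.root (w • i)) = P.RootForm (P.root i) (P.root i) := by
  rw [root_smul, rootForm_smul_smul]

lemma coroot'_eq_div (i : ι) (x : M) :
    P.coroot' i x = 2 * P.RootForm x (P.root i) / P.RootForm (P.root i) (P.root i) := by
  rw [eq_div_iff (rootForm_root_pos P i).ne', two_mul_rootForm]

lemma coroot'_smul_smul (w : P.weylGroup) (i : ι) (x : M) :
    P.coroot' (w • i) (w • x) = P.coroot' i x := by
  rw [coroot'_eq_div, coroot'_eq_div, rootForm_root_smul, root_smul, rootForm_smul_smul]

lemma coroot'_smul_left (w : P.weylGroup) (i : ι) (x : M) :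
    P.coroot' (w • i) x = P.coroot' i (w⁻¹ • x) := by
  rw [← coroot'_smul_smul P w i (w⁻¹ • x), smul_inv_smul]

lemma ofIdx_inv (i : ι) : (weylGroup.ofIdx P i)⁻¹ = weylGroup.ofIdx P i :=
  Subtype.ext (Equiv.reflection_inv P i)

lemma ofIdx_mul_self (i : ι) : weylGroup.ofIdx P i * weylGroup.ofIdx P i = 1 := by
  rw [mul_eq_one_iff_eq_inv, ofIdx_inv]

lemma coroot'_ofIdx_smul_self (i : ι) (x : M) :
    P.coroot' i (weylGroup.ofIdx P i • x) = -P.coroot' i x := by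
  rw [ofIdx_smul_eq, map_sub, map_smul, P.root_coroot'_eq_pairing, P.pairing_same, smul_eq_mul]
  ring

/-- The Weyl group element is determined by its action on the weight space. -/
lemma weylGroup_ext {w w' : P.weylGroup} (h : ∀ x : M, w • x = w' • x) : w = w' := by
  apply Subtype.ext
  apply RootPairing.Equiv.weightHom_injective P
  apply LinearEquiv.toLinearMap_injective
  exact LinearMap.ext h

lemma ofIdx_smul_idx (w : P.weylGroup) (i : ι) :
    weylGroup.ofIdx P (w • i) = w * weylGroup.ofIdx P i * w⁻¹ := by
  refine weylGroup_ext P fun x => ?_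
  rw [mul_smul, mul_smul, ofIdx_smul_eq, ofIdx_smul_eq, coroot'_smul_left, root_smul, smul_sub,
    smul_inv_smul, smul_comm w]

/-- Roots of equal length which are not orthogonal are conjugate. -/
lemma exists_smul_eq_of_pairing_ne_zero [P.IsCrystallographic] {i j : ι}
    (hl : P.RootForm (P.root i) (P.root i) = P.RootForm (P.root j) (P.root j))
    (h0 : P.pairing i j ≠ 0) : ∃ w : P.weylGroup, w • i = j := by
  have hmem := P.pairingIn_pairingIn_mem_set_of_length_eq (B := P.toInvariantForm) hl
  have hc : ∀ a b : ι, ((P.pairingIn ℤ a b : ℤ) : ℝ) = P.pairing a b :=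
    fun a b => P.algebraMap_pairingIn ℤ a b
  have h0' : P.pairingIn ℤ i j ≠ 0 := fun h => h0 (by rw [← hc, h, Int.cast_zero])
  simp only [Set.mem_insert_iff, Set.mem_singleton_iff, Prod.mk.injEq] at hmem
  -- the form is positive definite, so vectors at distance zero are equal
  have key : ∀ x y : M, P.RootForm (x - y) (x - y) = 0 → x - y ∈ P.rootSpan ℝ → x = y :=
    fun x y h hm => sub_eq_zero.mp
      (P.eq_zero_of_mem_rootSpan_of_rootForm_self_eq_zero hm h)
  have hr : ∀ a : ι, P.root a ∈ P.rootSpan ℝ := fun a => Submodule.subset_span ⟨a, rfl⟩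
  have h2 := two_mul_rootForm P j (P.root i)
  rw [P.root_coroot'_eq_pairing] at h2
  have hcm := rootForm_comm P (P.root i) (P.root j)
  rcases hmem with h | h | h | h | h
  · exact absurd h.1 h0'
  · -- the reflections in `β`, `α`, `β` carry `α` to `α - β`, then to `-β`, then to `β`
    have h1 : P.pairing i j = 1 := by rw [← hc, h.1]; simp
    have h1' : P.pairing j i = 1 := by rw [← hc, h.2]; simp
    refine ⟨weylGroup.ofIdx P j * (weylGroup.ofIdx P i * weylGroup.ofIdx P j), ?_⟩
    apply P.root.injective
    simp only [root_smul, mul_smul, ofIdx_smul_eq, P.root_coroot'_eq_pairing, map_sub, map_smul,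
      h1, h1', P.pairing_same, smul_eq_mul]
    module
  · have h1 : P.pairing i j = -1 := by rw [← hc, h.1]; simp
    have h1' : P.pairing j i = -1 := by rw [← hc, h.2]; simp
    refine ⟨weylGroup.ofIdx P i * weylGroup.ofIdx P j, ?_⟩
    apply P.root.injective
    simp only [root_smul, mul_smul, ofIdx_smul_eq, P.root_coroot'_eq_pairing, map_sub, map_smul,
      h1, h1', P.pairing_same, smul_eq_mul]
    module
  · have h1 : P.pairing i j = 2 := by rw [← hc, h.1]; simp
    refine ⟨1, ?_⟩
    rw [one_smul]
    apply P.root.injective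
    refine key _ _ ?_ (sub_mem (hr i) (hr j))
    simp only [map_sub, LinearMap.sub_apply]
    rw [h1] at h2
    linarith
  · have h1 : P.pairing i j = -2 := by rw [← hc, h.1]; simp
    refine ⟨weylGroup.ofIdx P i, ?_⟩
    apply P.root.injective
    rw [root_reflection_smul_self]
    refine key _ _ ?_ (sub_mem (neg_mem (hr i)) (hr j))
    simp only [map_sub, map_neg, LinearMap.neg_apply, LinearMap.sub_apply]
    rw [h1] at h2
    linarith

end Form

/-! ### Coefficients on the simple roots -/

section Coef
variable [Fintype ι] {P : RootPairing ι ℝ M N} [P.IsRootSystem] (b : P.Base)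

/-- The coefficient of a simple root in the expansion of a vector on the simple roots; it is the
pairing with a fundamental coweight. -/
def coef (l : b.support) : M →ₗ[ℝ] ℝ := b.toWeightBasis.coord l

open scoped Classical in
lemma coef_root_simple (l j : b.support) : coef b l (P.root j) = if j = l then 1 else 0 := by
  rw [coef, Module.Basis.coord_apply, b.toWeightBasis_repr_root, Finsupp.single_apply]

lemma coef_root_self (l : b.support) : coef b l (P.root l) = 1 := by
  classical
  rw [coef_root_simple, if_pos rfl]

lemma coef_root_of_ne {l j : b.support} (h : j ≠ l) : coef b l (P.root j) = 0 := by
  classical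
  rw [coef_root_simple, if_neg h]

lemma sum_coef_smul_root (x : M) : ∑ l, coef b l x • P.root (l : ι) = x := by
  conv_rhs => rw [← b.toWeightBasis.sum_repr x]
  refine Finset.sum_congr rfl fun l _ => ?_
  rw [b.toWeightBasis_apply]
  rfl

lemma coef_ext {x y : M} (h : ∀ l, coef b l x = coef b l y) : x = y := by
  rw [← sum_coef_smul_root b x, ← sum_coef_smul_root b y]
  simp only [h]

lemma exists_int_coef {x : M} (hx : x ∈ P.rootSpan ℤ) (l : b.support) :
    ∃ n : ℤ, coef b l x = n := by
  replace hx : x ∈ Submodule.span ℤ (P.root '' b.support) := by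
    rw [b.span_int_root_support]
    exact hx
  induction hx using Submodule.span_induction with
  | mem x hx =>
    obtain ⟨j, hj, rfl⟩ := hx
    by_cases h : (⟨j, hj⟩ : b.support) = l
    · exact ⟨1, by rw [← h]; simpa using coef_root_self b ⟨j, hj⟩⟩
    · exact ⟨0, by simpa using coef_root_of_ne b h⟩
  | zero => exact ⟨0, by simp⟩
  | add x y _ _ hx hy =>
    obtain ⟨m, hm⟩ := hx
    obtain ⟨n, hn⟩ := hy
    exact ⟨m + n, by rw [map_add, hm, hn]; push_cast; rfl⟩
  | smul a x _ hx =>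
    obtain ⟨m, hm⟩ := hx
    exact ⟨a * m, by rw [map_zsmul, hm, zsmul_eq_mul]; push_cast; rfl⟩

lemma root_mem_rootSpan (i : ι) : P.root i ∈ P.rootSpan ℤ := Submodule.subset_span ⟨i, rfl⟩

lemma exists_int_coef_root (i : ι) (l : b.support) : ∃ n : ℤ, coef b l (P.root i) = n :=
  exists_int_coef b (root_mem_rootSpan i) l

lemma height_eq_sum_coef (i : ι) : (b.height i : ℝ) = ∑ l, coef b l (P.root i) := by
  choose n hn using fun l => exists_int_coef_root b i l
  classical
  have h : P.root i = ∑ j ∈ b.support, (fun j => if h : j ∈ b.support then n ⟨j, h⟩ else 0) j •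
      P.root j := by
    conv_lhs => rw [← sum_coef_smul_root b (P.root i)]
    rw [← Finset.sum_coe_sort b.support]
    refine Finset.sum_congr rfl fun l _ => ?_
    simp [hn, Int.cast_smul_eq_zsmul]
  rw [RootPairing.Base.height_eq_sum h, ← Finset.sum_coe_sort b.support]
  push_cast
  refine Finset.sum_congr rfl fun l _ => ?_
  simp [hn]

lemma coef_nonneg_or_nonpos (i : ι) :
    (∀ l, 0 ≤ coef b l (P.root i)) ∨ (∀ l, coef b l (P.root i) ≤ 0) := by
  have key : ∀ x ∈ AddSubmonoid.closure (P.root '' b.support), ∀ l, 0 ≤ coef b l x := by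
    intro x hx l
    induction hx using AddSubmonoid.closure_induction with
    | mem x hx =>
      obtain ⟨j, hj, rfl⟩ := hx
      classical
      have := coef_root_simple b l ⟨j, hj⟩
      rw [this]
      split_ifs <;> simp
    | zero => simp
    | add x y _ _ hx hy => rw [map_add]; exact add_nonneg hx hy
  rcases b.root_mem_or_neg_mem i with h | h
  · exact Or.inl (key _ h)
  · refine Or.inr fun l => ?_
    have := key _ h l
    rw [map_neg] at this
    linarith

lemma isPos_iff_coef_nonneg (i : ι) : b.IsPos i ↔ ∀ l, 0 ≤ coef b l (P.root i) := by
  rw [RootPairing.Base.isPos_iff', ← Int.cast_nonneg_iff (R := ℝ), height_eq_sum_coef]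
  refine ⟨fun h => ?_, fun h => Finset.sum_nonneg fun l _ => h l⟩
  rcases coef_nonneg_or_nonpos b i with h' | h'
  · exact h'
  · intro l
    have h0 : ∑ l, coef b l (P.root i) = 0 := le_antisymm (Finset.sum_nonpos fun l _ => h' l) h
    have := (Finset.sum_eq_zero_iff_of_nonpos fun l _ => h' l).mp h0 l (Finset.mem_univ l)
    exact this.ge

lemma coef_nonpos_of_not_isPos {i : ι} (h : ¬ b.IsPos i) (l : b.support) :
    coef b l (P.root i) ≤ 0 := by
  rcases coef_nonneg_or_nonpos b i with h' | h'
  · exact absurd ((isPos_iff_coef_nonneg b i).mpr h') h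
  · exact h' l

lemma isPos_of_coef_pos {i : ι} {l : b.support} (h : 0 < coef b l (P.root i)) : b.IsPos i := by
  by_contra h'
  exact absurd (coef_nonpos_of_not_isPos b h' l) (not_le.mpr h)

lemma exists_coef_pos {i : ι} (h : b.IsPos i) : ∃ l, 0 < coef b l (P.root i) := by
  by_contra! h'
  have h0 : ∀ l, coef b l (P.root i) = coef b l 0 := fun l => by
    rw [map_zero]
    exact le_antisymm (h' l) ((isPos_iff_coef_nonneg b i).mp h l)
  exact P.ne_zero i (coef_ext b h0)

lemma isPos_reflection_self_iff (i : ι) :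
    b.IsPos (weylGroup.ofIdx P i • i) ↔ ¬ b.IsPos i := by
  constructor
  · intro h h'
    obtain ⟨l, hl⟩ := exists_coef_pos b h'
    have := (isPos_iff_coef_nonneg b _).mp h l
    rw [root_reflection_smul_self, map_neg] at this
    linarith
  · intro h
    rw [isPos_iff_coef_nonneg]
    intro l
    rw [root_reflection_smul_self, map_neg]
    have := coef_nonpos_of_not_isPos b h l
    linarith

lemma isPos_smul_simple [P.IsCrystallographic] [P.IsReduced] {i j : ι} (hi : b.IsPos i)
    (hj : j ∈ b.support) (hij : i ≠ j) : b.IsPos (weylGroup.ofIdx P j • i) :=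
  hi.reflectionPerm hj hij

lemma coef_reflection (j l : b.support) (x : M) :
    coef b l (weylGroup.ofIdx P (j : ι) • x) =
      coef b l x - P.coroot' (j : ι) x * coef b l (P.root j) := by
  rw [ofIdx_smul_eq, map_sub, map_smul, smul_eq_mul]

lemma rootForm_eq_sum_coef (v x : M) :
    P.RootForm v x = ∑ l, coef b l x * P.RootForm v (P.root (l : ι)) := by
  conv_lhs => rw [← sum_coef_smul_root b x]
  simp only [map_sum, map_smul, smul_eq_mul]

lemma rootForm_simple_nonneg {v : M} (hv : v ∈ dominantCone b) (l : b.support) :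
    0 ≤ P.RootForm v (P.root (l : ι)) := by
  have h1 := two_mul_rootForm P (l : ι) v
  have h2 := mul_nonneg (hv l l.2) (rootForm_root_pos P (l : ι)).le
  linarith

lemma rootForm_nonneg_of_dominant {v x : M} (hv : v ∈ dominantCone b)
    (hx : ∀ l, 0 ≤ coef b l x) : 0 ≤ P.RootForm v x := by
  rw [rootForm_eq_sum_coef b]
  exact Finset.sum_nonneg fun l _ => mul_nonneg (hx l) (rootForm_simple_nonneg b hv l)

lemma coroot'_nonneg_of_dominant {v : M} (hv : v ∈ dominantCone b) {i : ι} (hi : b.IsPos i) :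
    0 ≤ P.coroot' i v := by
  rw [coroot'_eq_div]
  have := rootForm_nonneg_of_dominant b hv ((isPos_iff_coef_nonneg b i).mp hi)
  have := rootForm_root_pos P i
  positivity

end Coef

/-! ### Words in the simple reflections -/

section Words
variable [Fintype ι] {P : RootPairing ι ℝ M N} [P.IsRootSystem] [P.IsCrystallographic]
  [P.IsReduced] (b : P.Base)

/-- The Weyl group element spelled by a word in the simple reflections. -/
def wordProd (l : List b.support) : P.weylGroup :=
  (l.map fun i => weylGroup.ofIdx P (i : ι)).prod

lemma wordProd_cons (i : b.support) (l : List b.support) :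
    wordProd b (i :: l) = weylGroup.ofIdx P (i : ι) * wordProd b l := by
  simp [wordProd]

lemma wordProd_append (l l' : List b.support) :
    wordProd b (l ++ l') = wordProd b l * wordProd b l' := by
  simp [wordProd]

lemma wordProd_singleton (i : b.support) : wordProd b [i] = weylGroup.ofIdx P (i : ι) := by
  simp [wordProd]

lemma wordProd_nil : wordProd b [] = 1 := rfl

/-- The simple reflections generate the Weyl group. -/
lemma exists_wordProd_eq (w : P.weylGroup) : ∃ l, wordProd b l = w := by
  have hrefl : ∀ i, ∃ l, wordProd b l = weylGroup.ofIdx P i := by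
    intro i
    refine b.induction_reflect i (p := fun i => ∃ l, wordProd b l = weylGroup.ofIdx P i) ?_ ?_ ?_
    · rintro i ⟨l, hl⟩
      refine ⟨l, ?_⟩
      rw [hl]
      have := ofIdx_smul_idx P (weylGroup.ofIdx P i) i
      rw [mul_inv_cancel_right] at this
      exact this.symm
    · intro i hi
      exact ⟨[⟨i, hi⟩], wordProd_singleton b _⟩
    · rintro i j ⟨l, hl⟩ hj
      refine ⟨[⟨j, hj⟩] ++ (l ++ [⟨j, hj⟩]), ?_⟩
      have := ofIdx_smul_idx P (weylGroup.ofIdx P j) i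
      rw [ofIdx_inv] at this
      rw [wordProd_append, wordProd_append, wordProd_singleton, hl, ← mul_assoc]
      exact this.symm
  obtain ⟨w, hw⟩ := w
  induction hw using weylGroup.induction with
  | mem i => exact hrefl i
  | one => exact ⟨[], rfl⟩
  | mul x y hx hy h h' =>
    obtain ⟨l, hl⟩ := h
    obtain ⟨l', hl'⟩ := h'
    exact ⟨l ++ l', by rw [wordProd_append, hl, hl']; rfl⟩

lemma length_le_of_word (l : List b.support) : length b (wordProd b l) ≤ l.length :=
  Nat.sInf_le ⟨l, rfl, rfl⟩

lemma exists_word_length (w : P.weylGroup) :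
    ∃ l : List b.support, l.length = length b w ∧ wordProd b l = w := by
  obtain ⟨l, hl⟩ := exists_wordProd_eq b w
  exact Nat.sInf_mem (s := {n | ∃ l : List b.support, l.length = n ∧ wordProd b l = w})
    ⟨l.length, l, rfl, hl⟩

/-- The exchange property. -/
lemma exists_shorter_word (i : b.support) :
    ∀ l : List b.support, ¬ b.IsPos (wordProd b l • (i : ι)) →
      ∃ l' : List b.support, l'.length + 1 = l.length ∧
        wordProd b l' = wordProd b l * weylGroup.ofIdx P (i : ι)
  | [], h => absurd (by simpa [wordProd_nil] using b.isPos_of_mem_support i.2) h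
  | j :: l, h => by
    by_cases hl : b.IsPos (wordProd b l • (i : ι))
    · -- the simple reflection `s_j` makes only the simple root `α_j` negative
      have hj : wordProd b l • (i : ι) = j := by
        by_contra hne
        apply h
        rw [wordProd_cons, mul_smul]
        exact isPos_smul_simple b hl j.2 hne
      refine ⟨l, rfl, ?_⟩
      rw [wordProd_cons, ← hj, ofIdx_smul_idx, inv_mul_cancel_right, mul_assoc, ofIdx_mul_self,
        mul_one]
    · obtain ⟨l', hlen, hprod⟩ := exists_shorter_word i l hl
      exact ⟨j :: l', by simp [hlen], by rw [wordProd_cons, wordProd_cons, hprod, mul_assoc]⟩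

lemma length_mul_lt {w : P.weylGroup} {i : b.support} (h : ¬ b.IsPos (w • (i : ι))) :
    length b (w * weylGroup.ofIdx P (i : ι)) < length b w := by
  obtain ⟨l, hlen, rfl⟩ := exists_word_length b w
  obtain ⟨l', hlen', hprod⟩ := exists_shorter_word b i l h
  rw [← hprod]
  have := length_le_of_word b l'
  omega

lemma length_one : length b (1 : P.weylGroup) = 0 :=
  Nat.le_zero.mp (length_le_of_word b [])

lemma eq_one_of_length_eq_zero {w : P.weylGroup} (h : length b w = 0) : w = 1 := by
  obtain ⟨l, hlen, rfl⟩ := exists_word_length b w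
  rw [h, List.length_eq_zero_iff] at hlen
  rw [hlen, wordProd_nil]

/-! ### Dominant vectors -/

lemma coef_smul_smul (w : P.weylGroup) (l : b.support) (c : ℝ) (x : M) :
    coef b l (w • c • x) = c * coef b l (w • x) := by
  rw [smul_comm w c x, map_smul, smul_eq_mul]

/-- A dominant vector is the highest of its orbit. -/
lemma coef_smul_le {v : M} (hv : v ∈ dominantCone b) (w : P.weylGroup) (l : b.support) :
    coef b l (w • v) ≤ coef b l v := by
  induction hn : length b w using Nat.strong_induction_on generalizing w with
  | _ n ih =>
    obtain ⟨L, hlen, hL⟩ := exists_word_length b w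
    rcases List.eq_nil_or_concat L with rfl | ⟨L', i, rfl⟩
    · rw [← hL, wordProd_nil, one_smul]
    · rw [List.concat_eq_append, wordProd_append, wordProd_singleton] at hL
      rw [List.length_concat] at hlen
      have hlen' := length_le_of_word b L'
      have hpos : b.IsPos (wordProd b L' • (i : ι)) := by
        by_contra h
        have := length_mul_lt b h
        rw [hL] at this
        omega
      have hle := ih _ (by omega) (wordProd b L') rfl
      have h1 := (isPos_iff_coef_nonneg b _).mp hpos l
      rw [root_smul] at h1
      have h2 := mul_nonneg (hv i i.2) h1
      rw [← hL, mul_smul, ofIdx_smul_eq, smul_sub, map_sub, coef_smul_smul]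
      linarith

/-- Each orbit contains only one dominant vector. -/
lemma eq_of_dominant_of_dominant {v : M} (hv : v ∈ dominantCone b) {w : P.weylGroup}
    (hw : w • v ∈ dominantCone b) : w • v = v := by
  refine coef_ext b fun l => le_antisymm (coef_smul_le b hv w l) ?_
  have := coef_smul_le b hw w⁻¹ l
  rwa [inv_smul_smul] at this

lemma dom_mem_dominantCone (v : M) : dom b v ∈ dominantCone b :=
  Function.argminOn_mem (length b) {w : P.weylGroup | w⁻¹ • v ∈ dominantCone b}
    (exists_dominant b v)

lemma minElt_smul_dom (v : M) : minElt b v • dom b v = v := smul_inv_smul _ _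

lemma length_minElt_le {v : M} {w : P.weylGroup} (hw : w⁻¹ • v ∈ dominantCone b) :
    length b (minElt b v) ≤ length b w :=
  Function.argminOn_le (length b) {w : P.weylGroup | w⁻¹ • v ∈ dominantCone b} hw

lemma minElt_of_dominant {v : M} (hv : v ∈ dominantCone b) : minElt b v = 1 := by
  apply eq_one_of_length_eq_zero b
  have := length_minElt_le b (v := v) (w := 1) (by rwa [inv_one, one_smul])
  rw [length_one] at this
  omega

/-- `w_v` is the minimal element of its coset modulo the stabilizer of `v_dom`: it keeps positive
the positive roots orthogonal to `v_dom`. -/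
lemma isPos_minElt_smul {v : M} {i : ι} (hi : b.IsPos i) (h0 : P.coroot' i (dom b v) = 0) :
    b.IsPos (minElt b v • i) := by
  have hd := dom_mem_dominantCone b v
  have hsimple : ∀ l : b.support, P.coroot' (l : ι) (dom b v) = 0 →
      b.IsPos (minElt b v • (l : ι)) := by
    intro l hl
    by_contra hneg
    refine absurd (length_minElt_le b (v := v) (w := minElt b v * weylGroup.ofIdx P (l : ι)) ?_)
      (not_le.mpr (length_mul_lt b hneg))
    rw [mul_inv_rev, mul_smul, ofIdx_inv, ofIdx_smul_eq]
    change dom b v - P.coroot' (l : ι) (dom b v) • P.root (l : ι) ∈ dominantCone b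
    rw [hl, zero_smul, sub_zero]
    exact hd
  have hc := (isPos_iff_coef_nonneg b i).mp hi
  have hB : ∑ l, coef b l (P.root i) * P.RootForm (dom b v) (P.root (l : ι)) = 0 := by
    rw [← rootForm_eq_sum_coef b]
    have := two_mul_rootForm P i (dom b v)
    rw [h0] at this
    linarith
  have hB' := (Finset.sum_eq_zero_iff_of_nonneg fun l _ =>
    mul_nonneg (hc l) (rootForm_simple_nonneg b hd l)).mp hB
  rw [isPos_iff_coef_nonneg]
  intro m
  rw [root_smul, ← sum_coef_smul_root b (P.root i), Finset.smul_sum, map_sum]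
  refine Finset.sum_nonneg fun l hl => ?_
  rw [coef_smul_smul]
  rcases mul_eq_zero.mp (hB' l hl) with h | h
  · rw [h, zero_mul]
  · refine mul_nonneg (hc l) ?_
    have h2 := two_mul_rootForm P (l : ι) (dom b v)
    rw [h, mul_zero, eq_comm, mul_eq_zero] at h2
    have h3 := hsimple l (h2.resolve_right (rootForm_root_pos P _).ne')
    rw [← root_smul]
    exact (isPos_iff_coef_nonneg b _).mp h3 m

/-! ### Permutohedra by inequalities -/

/-- The vectors all of whose conjugates lie below `v`, in the sense that the difference is a
nonnegative combination of simple roots. For dominant `v` this is the permutohedron of `v`. -/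
def saturation (v : M) : Set M :=
  {x | ∀ (w : P.weylGroup) (l : b.support), coef b l (w • x) ≤ coef b l v}

lemma smul_mem_saturation_iff (w : P.weylGroup) (v x : M) :
    w • x ∈ saturation b v ↔ x ∈ saturation b v := by
  constructor
  · intro h u l
    have := h (u * w⁻¹) l
    rwa [mul_smul, inv_smul_smul] at this
  · intro h u l
    rw [smul_smul]
    exact h _ l

lemma convex_saturation (v : M) : Convex ℝ (saturation b v) := by
  intro x hx y hy s t hs ht hst w l
  rw [smul_add, map_add, coef_smul_smul, coef_smul_smul]
  have h1 := mul_le_mul_of_nonneg_left (hx w l) hs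
  have h2 := mul_le_mul_of_nonneg_left (hy w l) ht
  have h3 : coef b l v = s * coef b l v + t * coef b l v := by rw [← add_mul, hst, one_mul]
  linarith

/-- A dominant vector below `v` is in the saturated set of `v`. -/
lemma mem_saturation_of_dominant {v x : M} (hx : x ∈ dominantCone b)
    (h : ∀ l, coef b l x ≤ coef b l v) : x ∈ saturation b v :=
  fun w l => (coef_smul_le b hx w l).trans (h l)

lemma self_mem_permutohedron (v : M) (w : P.weylGroup) : w • v ∈ permutohedron P v :=
  subset_convexHull ℝ _ (MulAction.mem_orbit v w)

/-- The inequalities are necessary since a dominant vector is the highest of its orbit; they are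
sufficient since a linear functional `⟨u, ·⟩` separating `x` from the orbit of `v` could be moved
to one with `u` dominant, which is monotone. -/
lemma permutohedron_eq_saturation {v : M} (hv : v ∈ dominantCone b) :
    permutohedron P v = saturation b v := by
  apply Set.Subset.antisymm
  · refine convexHull_min ?_ (convex_saturation b v)
    rintro _ ⟨w, rfl⟩
    exact (smul_mem_saturation_iff b w v v).mpr fun u l => coef_smul_le b hv u l
  · intro x hx
    by_contra hxn
    have := finite_weylGroup P
    have hfd : FiniteDimensional ℝ M := b.toWeightBasis.finiteDimensional_of_finite
    let e : M ≃ₗ[ℝ] (b.support → ℝ) := b.toWeightBasis.equivFun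
    have himg : e '' permutohedron P v = convexHull ℝ (e '' MulAction.orbit P.weylGroup v) :=
      LinearMap.image_convexHull e.toLinearMap _
    have hfin : (e '' MulAction.orbit P.weylGroup v).Finite :=
      (Set.finite_range fun w : P.weylGroup => w • v).image _
    have hex : e x ∉ e '' permutohedron P v := by
      rintro ⟨y, hy, hyx⟩
      exact hxn (e.injective hyx ▸ hy)
    rw [himg] at hex
    obtain ⟨f, s, hfs, hsx⟩ := geometric_hahn_banach_closed_point (convex_convexHull ℝ _)
      (hfin.isClosed_convexHull ℝ) hex
    let g : Module.Dual ℝ M := f.toLinearMap ∘ₗ e.toLinearMap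
    have hB : P.RootForm.Nondegenerate := P.rootForm_nondegenerate
    let u : M := (LinearMap.BilinForm.toDual P.RootForm hB).symm g
    have hu : ∀ y, P.RootForm u y = g y := fun y =>
      LinearMap.BilinForm.apply_toDual_symm_apply (hB := hB) g y
    obtain ⟨w, hw⟩ := exists_dominant b u
    have hle : P.RootForm u x ≤ P.RootForm u (w • v) := by
      have h1 := rootForm_nonneg_of_dominant b (x := v - w⁻¹ • x) hw
        (fun l => by rw [map_sub]; linarith [hx w⁻¹ l])
      rw [rootForm_smul_left, inv_inv, smul_sub, smul_inv_smul, map_sub] at h1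
      linarith
    have h2 : f (e (w • v)) < s := by
      refine hfs _ ?_
      rw [← himg]
      exact ⟨_, self_mem_permutohedron v w, rfl⟩
    have h3 : s < f (e x) := hsx
    rw [hu, hu] at hle
    exact absurd (h2.trans h3) (not_lt.mpr hle)

end Words

/-! ### Root lengths and goodness -/

section Lengths
variable [Fintype ι] {P : RootPairing ι ℝ M N} [P.IsRootSystem] [P.IsCrystallographic]
  [P.IsReduced] (b : P.Base)

variable (P) in
lemma coroot'_root_eq_intCast (i j : ι) : P.coroot' j (P.root i) = (P.pairingIn ℤ i j : ℝ) := by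
  rw [P.root_coroot'_eq_pairing]
  exact (P.algebraMap_pairingIn ℤ i j).symm

lemma coroot'_simple_nonpos {l m : b.support} (h : m ≠ l) :
    P.coroot' (l : ι) (P.root (m : ι)) ≤ 0 := by
  rw [coroot'_root_eq_intCast]
  exact_mod_cast b.pairingIn_le_zero_of_ne (fun h' => h (Subtype.ext h')) m.2 l.2

lemma coroot'_eq_sum_coef (i : ι) (x : M) :
    P.coroot' i x = ∑ m, coef b m x * P.coroot' i (P.root (m : ι)) := by
  conv_lhs => rw [← sum_coef_smul_root b x]
  simp only [map_sum, map_smul, smul_eq_mul]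

/-- The off-diagonal entries of the Cartan matrix are nonpositive. -/
lemma coroot'_le_two_mul_coef {x : M} {l : b.support} (hx : ∀ m, m ≠ l → 0 ≤ coef b m x) :
    P.coroot' (l : ι) x ≤ 2 * coef b l x := by
  classical
  rw [coroot'_eq_sum_coef b, ← Finset.add_sum_erase _ _ (Finset.mem_univ l),
    P.root_coroot'_eq_pairing, P.pairing_same]
  have : ∑ m ∈ Finset.univ.erase l, coef b m x * P.coroot' (l : ι) (P.root (m : ι)) ≤ 0 :=
    Finset.sum_nonpos fun m hm => mul_nonpos_of_nonneg_of_nonpos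
      (hx m (Finset.ne_of_mem_erase hm)) (coroot'_simple_nonpos b (Finset.ne_of_mem_erase hm))
  linarith

lemma height_reflection (i : ι) (l : b.support) :
    (b.height (weylGroup.ofIdx P (l : ι) • i) : ℝ) =
      b.height i - P.coroot' (l : ι) (P.root i) := by
  classical
  rw [height_eq_sum_coef, height_eq_sum_coef, root_smul]
  simp only [coef_reflection, Finset.sum_sub_distrib, ← Finset.mul_sum, coef_root_simple,
    Finset.sum_ite_eq, Finset.mem_univ, if_true, mul_one]

/-- Every positive root is obtained from a simple one by reflections in simple roots, each of which
increases the height. -/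
lemma isPos_induction {p : ι → Prop} (simple : ∀ l : b.support, p l)
    (step : ∀ (i : ι) (l : b.support), b.IsPos i → b.IsPos (weylGroup.ofIdx P (l : ι) • i) →
      0 < P.coroot' (l : ι) (P.root i) → p (weylGroup.ofIdx P (l : ι) • i) → p i)
    (i : ι) (hi : b.IsPos i) : p i := by
  induction hn : (b.height i).toNat using Nat.strong_induction_on generalizing i with
  | _ n ih =>
    by_cases his : i ∈ b.support
    · exact simple ⟨i, his⟩
    · obtain ⟨j, hj, hj'⟩ := hi.exists_mem_support_pos_pairingIn
      rw [P.zero_lt_pairingIn_iff'] at hj'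
      have hpos : 0 < P.coroot' j (P.root i) := by
        rw [coroot'_root_eq_intCast]
        exact_mod_cast hj'
      have hne : i ≠ j := fun h => his (h ▸ hj)
      have hsp := isPos_smul_simple b hi hj hne
      have hh := height_reflection b i ⟨j, hj⟩
      have hlt : b.height (weylGroup.ofIdx P j • i) < b.height i := by
        have : (b.height (weylGroup.ofIdx P j • i) : ℝ) < b.height i := by
          rw [hh]
          linarith
        exact_mod_cast this
      have h0 : 0 < b.height (weylGroup.ofIdx P j • i) := hsp
      refine step i ⟨j, hj⟩ hi hsp hpos (ih _ ?_ _ hsp rfl)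
      change (b.height (weylGroup.ofIdx P j • i)).toNat < n
      omega

/-- The support of a positive root contains a simple root conjugate to it. -/
lemma exists_conj_simple {i : ι} (hi : b.IsPos i) :
    ∃ l : b.support, (∃ w : P.weylGroup, w • i = l) ∧ 0 < coef b l (P.root i) := by
  refine isPos_induction b (p := fun i => ∃ l : b.support, (∃ w : P.weylGroup, w • i = l) ∧
    0 < coef b l (P.root i)) ?_ ?_ i hi
  · exact fun l => ⟨l, ⟨1, one_smul _ _⟩, by rw [coef_root_self]; exact one_pos⟩
  · rintro i l - - hpos ⟨m, ⟨w, hw⟩, hm⟩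
    refine ⟨m, ⟨w * weylGroup.ofIdx P (l : ι), by rw [mul_smul, hw]⟩, ?_⟩
    rw [root_smul, coef_reflection] at hm
    have := mul_nonneg hpos.le
      ((isPos_iff_coef_nonneg b _).mp (b.isPos_of_mem_support l.2) m)
    linarith

lemma one_le_coef {i : ι} {l : b.support} (h : 0 < coef b l (P.root i)) :
    1 ≤ coef b l (P.root i) := by
  obtain ⟨n, hn⟩ := exists_int_coef_root b i l
  rw [hn] at h ⊢
  exact_mod_cast h

section Irreducible
variable [P.IsIrreducible]

/-- In an irreducible root system, roots of equal length are conjugate. -/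
lemma exists_smul_eq_of_length_eq {i j : ι}
    (hl : P.RootForm (P.root i) (P.root i) = P.RootForm (P.root j) (P.root j)) :
    ∃ w : P.weylGroup, w • i = j := by
  obtain ⟨w, hw⟩ : ∃ w : P.weylGroup, P.RootForm (P.root i) (P.root (w • j)) ≠ 0 := by
    by_contra! h
    have htop : (⊤ : Submodule ℝ M) ≤ LinearMap.ker (P.RootForm (P.root i)) := by
      rw [← P.span_orbit_eq_top j, Submodule.span_le]
      rintro _ ⟨w, rfl⟩
      have := h w
      rw [root_smul] at this
      exact this
    exact (rootForm_root_pos P i).ne' (htop (Submodule.mem_top (x := P.root i)))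
  obtain ⟨u, hu⟩ := exists_smul_eq_of_pairing_ne_zero P (i := i) (j := w • j)
    (by rw [hl, rootForm_root_smul]) (by
      intro h0
      have := two_mul_rootForm P (w • j) (P.root i)
      rw [P.root_coroot'_eq_pairing, h0, zero_mul] at this
      exact hw (by linarith))
  exact ⟨w⁻¹ * u, by rw [mul_smul, hu, inv_smul_smul]⟩

/-- Without multiple bonds in the Dynkin diagram all roots have the same length: the span of the
simple roots of one given length is invariant. -/
lemma length_eq_of_isSimplyLaced (h : IsSimplyLaced b) (i j : ι) :
    P.RootForm (P.root i) (P.root i) = P.RootForm (P.root j) (P.root j) := by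
  have hsimple : ∀ l m : b.support, P.RootForm (P.root (l : ι)) (P.root (l : ι)) =
      P.RootForm (P.root (m : ι)) (P.root (m : ι)) := by
    intro l m
    let S : Set b.support := {n | P.RootForm (P.root (n : ι)) (P.root (n : ι)) =
      P.RootForm (P.root (m : ι)) (P.root (m : ι))}
    let q : Submodule ℝ M := Submodule.span ℝ ((fun n : b.support => P.root (n : ι)) '' S)
    have horth : ∀ n ∈ S, ∀ a ∉ S, P.pairing (n : ι) (a : ι) = 0 := by
      intro n hn a ha
      have hna : (n : ι) ≠ a := fun h' => ha (Subtype.ext h' ▸ hn)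
      rcases h n n.2 a a.2 hna with h0 | h1
      · rcases mul_eq_zero.mp h0 with h0 | h0
        · exact h0
        · exact P.pairing_eq_zero_iff.mp h0
      · exfalso
        -- two integers with product one are both `1` or both `-1`
        have e1 := two_mul_rootForm P (a : ι) (P.root (n : ι))
        have e2 := two_mul_rootForm P (n : ι) (P.root (a : ι))
        rw [← P.root_coroot'_eq_pairing, ← P.root_coroot'_eq_pairing, coroot'_root_eq_intCast,
          coroot'_root_eq_intCast] at h1
        rw [coroot'_root_eq_intCast] at e1 e2
        have h1' : P.pairingIn ℤ (n : ι) (a : ι) * P.pairingIn ℤ (a : ι) (n : ι) = 1 := by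
          exact_mod_cast h1
        rw [rootForm_comm] at e2
        apply ha
        change P.RootForm _ _ = _
        rw [← show P.RootForm (P.root (n : ι)) (P.root (n : ι)) = _ from hn]
        rcases Int.mul_eq_one_iff_eq_one_or_neg_one.mp h1' with ⟨p, p'⟩ | ⟨p, p'⟩ <;>
        · rw [p] at e1
          rw [p'] at e2
          push_cast at e1 e2
          linarith
    have hinv : ∀ n ∈ b.support, q ∈ Module.End.invtSubmodule (P.reflection n) := by
      intro n hn
      rw [Module.End.mem_invtSubmodule, Submodule.span_le]
      rintro _ ⟨a, ha, rfl⟩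
      change P.reflection n (P.root (a : ι)) ∈ q
      rw [P.reflection_apply, P.root_coroot'_eq_pairing]
      have haq : P.root (a : ι) ∈ q := Submodule.subset_span ⟨a, ha, rfl⟩
      by_cases hnS : (⟨n, hn⟩ : b.support) ∈ S
      · exact q.sub_mem haq (q.smul_mem _ (Submodule.subset_span ⟨_, hnS, rfl⟩))
      · rw [horth a ha ⟨n, hn⟩ hnS, zero_smul, sub_zero]
        exact haq
    have hq : q = ⊤ := by
      refine RootPairing.IsIrreducible.eq_top_of_invtSubmodule_reflection q
        ((b.forall_mem_support_invtSubmodule_iff q).mp hinv) fun hbot => ?_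
      have : P.root (m : ι) ∈ q := Submodule.subset_span ⟨m, rfl, rfl⟩
      rw [hbot, Submodule.mem_bot] at this
      exact P.ne_zero _ this
    by_contra hl
    have hker : q ≤ LinearMap.ker (coef b l) := by
      rw [Submodule.span_le]
      rintro _ ⟨a, ha, rfl⟩
      exact coef_root_of_ne b fun h' => hl (h' ▸ ha)
    have : coef b l (P.root (l : ι)) = 0 := hker (hq ▸ Submodule.mem_top)
    rw [coef_root_self] at this
    exact one_ne_zero this
  have hall : ∀ a : ι, ∃ l : b.support, P.RootForm (P.root a) (P.root a) =
      P.RootForm (P.root (l : ι)) (P.root (l : ι)) := by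
    intro a
    refine b.induction_reflect a (p := fun a => ∃ l : b.support,
      P.RootForm (P.root a) (P.root a) = P.RootForm (P.root (l : ι)) (P.root (l : ι))) ?_ ?_ ?_
    · rintro c ⟨l, hl⟩
      exact ⟨l, (rootForm_root_smul P (weylGroup.ofIdx P c) c).trans hl⟩
    · exact fun c hc => ⟨⟨c, hc⟩, rfl⟩
    · rintro c d ⟨l, hl⟩ -
      exact ⟨l, (rootForm_root_smul P (weylGroup.ofIdx P d) c).trans hl⟩
  obtain ⟨l, hl⟩ := hall i
  obtain ⟨m, hm⟩ := hall j
  rw [hl, hm, hsimple l m]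

/-- The form in which goodness is used. -/
lemma eq_zero_of_length_lt {k : ι → ℕ} (hk : IsWeylInvariant P k) (hgood : IsGood b k) {i j : ι}
    (hlt : P.RootForm (P.root j) (P.root j) < P.RootForm (P.root i) (P.root i)) (hj : k j = 0) :
    k i = 0 := by
  have htwo : ∀ m, P.RootForm (P.root m) (P.root m) = P.RootForm (P.root i) (P.root i) ∨
      P.RootForm (P.root m) (P.root m) = P.RootForm (P.root j) (P.root j) := fun m =>
    RootPairing.InvariantForm.apply_eq_or_of_apply_ne P.toInvariantForm hlt.ne' m
  have hlong : IsLong P i := by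
    intro m
    rcases htwo m with h | h <;> rw [h]
    exact hlt.le
  refine hgood ?_ ?_ i hlong
  · intro hsl
    exact hlt.ne (length_eq_of_isSimplyLaced b hsl j i)
  · intro m hm
    rcases htwo m with h | h
    · exact absurd (fun a => h ▸ hlong a) hm
    · obtain ⟨w, hw⟩ := exists_smul_eq_of_length_eq h
      rw [← hk w m, hw, hj]

end Irreducible

end Lengths

/-! ### Comparing a root with the difference of two weights -/

section Compare
variable [Fintype ι] {P : RootPairing ι ℝ M N} [P.IsRootSystem] [P.IsCrystallographic]
  [P.IsReduced] (b : P.Base)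

/-- Among conjugate roots, the coroot pairing with a dominant vector is monotone. -/
lemma coroot'_le_coroot'_of_coef_le {v : M} (hv : v ∈ dominantCone b) {i j : ι}
    (hconj : ∃ w : P.weylGroup, w • i = j)
    (hle : ∀ l, coef b l (P.root j) ≤ coef b l (P.root i)) : P.coroot' j v ≤ P.coroot' i v := by
  obtain ⟨w, rfl⟩ := hconj
  have h := rootForm_nonneg_of_dominant b hv (x := P.root i - P.root (w • i))
    (fun l => by rw [map_sub]; linarith [hle l])
  rw [map_sub] at h
  rw [coroot'_eq_div, coroot'_eq_div, rootForm_root_smul]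
  exact div_le_div_of_nonneg_right (by linarith) (rootForm_root_pos P i).le

lemma mem_dominantCone_of_le {k : ι → ℕ} {v : M}
    (hv : ∀ l : b.support, (k l : ℝ) ≤ P.coroot' (l : ι) v) : v ∈ dominantCone b :=
  fun i hi => (Nat.cast_nonneg (k i)).trans (hv ⟨i, hi⟩)

lemma le_coroot'_of_isPos {k : ι → ℕ} (hk : IsWeylInvariant P k) {v : M}
    (hv : ∀ l : b.support, (k l : ℝ) ≤ P.coroot' (l : ι) v) {i : ι} (hi : b.IsPos i) :
    (k i : ℝ) ≤ P.coroot' i v := by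
  obtain ⟨l, ⟨w, hw⟩, hl⟩ := exists_conj_simple b hi
  have hd := mem_dominantCone_of_le b hv
  rw [coroot'_eq_div, le_div_iff₀ (rootForm_root_pos P i)]
  have h1 := Finset.single_le_sum (fun m _ => mul_nonneg ((isPos_iff_coef_nonneg b i).mp hi m)
    (rootForm_simple_nonneg b hd m)) (Finset.mem_univ l)
  have h2 := le_mul_of_one_le_left (rootForm_simple_nonneg b hd l) (one_le_coef b hl)
  have h3 := two_mul_rootForm P (l : ι) v
  have h4 := mul_le_mul_of_nonneg_right (hv l) (rootForm_root_pos P (l : ι)).le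
  rw [← rootForm_eq_sum_coef b] at h1
  rw [← hw, rootForm_root_smul] at h3 h4
  rw [hk] at h4
  rw [← hw] at h1 h2
  linarith

/-- A refinement of `le_coroot'_of_isPos` which keeps the contribution of one further simple
root. -/
lemma le_two_mul_rootForm {k : ι → ℕ} (hk : IsWeylInvariant P k) {v : M}
    (hv : ∀ l : b.support, (k l : ℝ) ≤ P.coroot' (l : ι) v) {i : ι} (hi : b.IsPos i)
    {j : b.support} (hj : ¬ ∃ w : P.weylGroup, w • i = j) :
    k i * P.RootForm (P.root i) (P.root i) + coef b j (P.root i) *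
      (P.coroot' (j : ι) v * P.RootForm (P.root (j : ι)) (P.root (j : ι))) ≤
        2 * P.RootForm v (P.root i) := by
  classical
  obtain ⟨l, ⟨w, hw⟩, hl⟩ := exists_conj_simple b hi
  have hlj : l ≠ j := fun h => hj ⟨w, h ▸ hw⟩
  have hd := mem_dominantCone_of_le b hv
  have h1 := Finset.sum_le_sum_of_subset_of_nonneg (Finset.subset_univ {l, j})
    (fun m _ _ => mul_nonneg ((isPos_iff_coef_nonneg b i).mp hi m) (rootForm_simple_nonneg b hd m))
  rw [Finset.sum_pair hlj, ← rootForm_eq_sum_coef b] at h1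
  have h2 := le_mul_of_one_le_left (rootForm_simple_nonneg b hd l) (one_le_coef b hl)
  have h3 := two_mul_rootForm P (l : ι) v
  have h4 := mul_le_mul_of_nonneg_right (hv l) (rootForm_root_pos P (l : ι)).le
  rw [← hw, rootForm_root_smul] at h3 h4
  rw [hk] at h4
  rw [← hw] at h1 h2
  rw [← two_mul_rootForm P (j : ι) v]
  linarith

/-- The Cauchy–Schwarz inequality for two conjugates of a root. -/
lemma rootForm_le_of_conj {i j : ι} (hconj : ∃ w : P.weylGroup, w • i = j) (w : P.weylGroup) :
    P.RootForm (P.root (w • i)) (P.root j) ≤ P.RootForm (P.root i) (P.root i) := by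
  obtain ⟨u, rfl⟩ := hconj
  have h := P.zero_le_rootForm (P.root (w • i) - P.root (u • i))
  simp only [map_sub, LinearMap.sub_apply] at h
  rw [rootForm_root_smul, rootForm_root_smul,
    rootForm_comm P (P.root (u • i)) (P.root (w • i))] at h
  linarith

/-- If a simple root `α_j` lies in the support of a positive root `α`, there is a positive conjugate
`y ≤ α` of `α` which pairs positively with `α_j` and with no other simple root, namely one of least
height among those with `α_j` in their support. -/
lemma exists_minimal_conj {i : ι} (hi : b.IsPos i) {j : b.support}
    (hij : 0 < coef b j (P.root i)) :
    ∃ y : ι, (∃ w : P.weylGroup, w • i = y) ∧ b.IsPos y ∧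
      (∀ l, coef b l (P.root y) ≤ coef b l (P.root i)) ∧
      (∀ l, l ≠ j → P.coroot' (l : ι) (P.root y) ≤ 0) ∧
      0 < P.coroot' (j : ι) (P.root y) := by
  classical
  let S : Set ι := {y | (∃ w : P.weylGroup, w • i = y) ∧ b.IsPos y ∧
    (∀ l, coef b l (P.root y) ≤ coef b l (P.root i)) ∧ 0 < coef b j (P.root y)}
  have hne : S.Nonempty := ⟨i, ⟨1, one_smul _ _⟩, hi, fun l => le_rfl, hij⟩
  obtain ⟨y, ⟨⟨w, hw⟩, hy, hle, hyj⟩, hmin⟩ := Set.exists_min_image S b.height S.toFinite hne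
  have hnp : ∀ l, l ≠ j → P.coroot' (l : ι) (P.root y) ≤ 0 := by
    intro l hl
    by_contra! hpos
    have hyl : y ≠ l := by
      rintro rfl
      rw [coef_root_of_ne b hl] at hyj
      exact lt_irrefl _ hyj
    have hcoef : ∀ m, coef b m (P.root (weylGroup.ofIdx P (l : ι) • y)) =
        coef b m (P.root y) - P.coroot' (l : ι) (P.root y) * coef b m (P.root (l : ι)) :=
      fun m => by rw [root_smul, coef_reflection]
    have hmem : weylGroup.ofIdx P (l : ι) • y ∈ S := by
      refine ⟨⟨weylGroup.ofIdx P (l : ι) * w, by rw [mul_smul, hw]⟩,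
        isPos_smul_simple b hy l.2 hyl, fun m => ?_, ?_⟩
      · rw [hcoef]
        have := mul_nonneg hpos.le
          ((isPos_iff_coef_nonneg b _).mp (b.isPos_of_mem_support l.2) m)
        linarith [hle m]
      · rw [hcoef, coef_root_of_ne b hl, mul_zero, sub_zero]
        exact hyj
    have h1 : (b.height y : ℝ) ≤ b.height (weylGroup.ofIdx P (l : ι) • y) := by
      exact_mod_cast hmin _ hmem
    rw [height_reflection] at h1
    linarith
  refine ⟨y, ⟨w, hw⟩, hy, hle, hnp, ?_⟩
  by_contra! hyj0
  have h := rootForm_eq_sum_coef b (P.root y) (P.root y)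
  have hsum : ∑ l, coef b l (P.root y) * P.RootForm (P.root y) (P.root (l : ι)) ≤ 0 := by
    refine Finset.sum_nonpos fun l _ => mul_nonpos_of_nonneg_of_nonpos
      ((isPos_iff_coef_nonneg b y).mp hy l) ?_
    have h1 : P.coroot' (l : ι) (P.root y) ≤ 0 := by
      by_cases hl : l = j
      · rwa [hl]
      · exact hnp l hl
    have h2 := two_mul_rootForm P (l : ι) (P.root y)
    have h3 := mul_nonpos_of_nonpos_of_nonneg h1 (rootForm_root_pos P (l : ι)).le
    linarith
  linarith [rootForm_root_pos P y]

variable {b}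

/-- The inductive step of `coef_root_le_coef_sub`, for a simple root conjugate to `α`. -/
lemma coef_le_of_conj {k : ι → ℕ} (hk : IsWeylInvariant P k) {v μ : M}
    (hv : ∀ l : b.support, (k l : ℝ) ≤ P.coroot' (l : ι) v) (hμ : μ ∈ dominantCone b)
    {i : ι} (hlt : P.coroot' i μ ≤ k i - 1)
    {β : ι} {j : b.support} (hβ : b.IsPos β) (hβ' : b.IsPos (weylGroup.ofIdx P (j : ι) • β))
    (hpos : 0 < P.coroot' (j : ι) (P.root β)) (hconj : ∃ w : P.weylGroup, w • i = β)
    (hle : ∀ l, coef b l (P.root β) ≤ coef b l (P.root i))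
    (ih : ∀ l, coef b l (P.root (weylGroup.ofIdx P (j : ι) • β)) ≤ coef b l (v - μ))
    (hj : ∃ w : P.weylGroup, w • i = j)
    (hd : coef b j (v - μ) ≤ coef b j (P.root β) - 1) : False := by
  have hβj : β ≠ j := by
    rintro rfl
    exact (isPos_reflection_self_iff b (j : ι)).mp hβ' hβ
  obtain ⟨u, hu⟩ := hj
  obtain ⟨w, hw⟩ := hconj
  have hlen : P.RootForm (P.root β) (P.root β) = P.RootForm (P.root (j : ι)) (P.root (j : ι)) := by
    rw [← hw, ← hu, rootForm_root_smul, rootForm_root_smul]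
  have ht : P.coroot' (j : ι) (P.root β) = 1 := by
    have hmem := P.pairingIn_pairingIn_mem_set_of_length_eq_of_ne (B := P.toInvariantForm) hlen hβj
      (by
        intro h
        rw [h, map_neg, P.root_coroot'_eq_pairing, P.pairing_same] at hpos
        linarith)
    rw [coroot'_root_eq_intCast] at hpos ⊢
    have hpos' : 0 < P.pairingIn ℤ β j := by exact_mod_cast hpos
    simp only [Set.mem_insert_iff, Set.mem_singleton_iff, Prod.mk.injEq] at hmem
    have : P.pairingIn ℤ β j = 1 := by omega
    rw [this, Int.cast_one]
  have hcoef := coef_reflection b j j (P.root β)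
  rw [ht, coef_root_self, ← root_smul, one_mul] at hcoef
  have h1 := coroot'_le_two_mul_coef b (l := j)
    (x := v - μ - P.root (weylGroup.ofIdx P (j : ι) • β))
    (fun m _ => by rw [map_sub]; linarith [ih m])
  have h2 : P.coroot' (j : ι) (P.root (weylGroup.ofIdx P (j : ι) • β)) = -1 := by
    rw [root_smul, coroot'_ofIdx_smul_self, ht]
  rw [map_sub, map_sub, h2, map_sub] at h1
  have hji : ∀ l, coef b l (P.root (j : ι)) ≤ coef b l (P.root i) := by
    intro l
    by_cases hlj : j = l
    · rw [← hlj, coef_root_self]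
      have := (isPos_iff_coef_nonneg b _).mp hβ' j
      linarith [hle j]
    · rw [coef_root_of_ne b hlj]
      exact ((isPos_iff_coef_nonneg b β).mp hβ l).trans (hle l)
  have h3 := coroot'_le_coroot'_of_coef_le b hμ ⟨u, hu⟩ hji
  have h4 := hv j
  rw [← hu, hk] at h4
  rw [hu] at h4
  linarith

/-- The inductive step of `coef_root_le_coef_sub`, for a simple root not conjugate to `α`. -/
lemma coef_le_of_not_conj [P.IsIrreducible] {k : ι → ℕ} (hk : IsWeylInvariant P k)
    (hgood : IsGood b k) {v μ : M}
    (hv : ∀ l : b.support, (k l : ℝ) ≤ P.coroot' (l : ι) v) (hμ : μ ∈ dominantCone b)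
    {i : ι} (hi : b.IsPos i) (hlt : P.coroot' i μ ≤ k i - 1)
    {β : ι} {j : b.support} (hβ' : b.IsPos (weylGroup.ofIdx P (j : ι) • β))
    (hpos : 0 < P.coroot' (j : ι) (P.root β)) (hconj : ∃ w : P.weylGroup, w • i = β)
    (hle : ∀ l, coef b l (P.root β) ≤ coef b l (P.root i))
    (ih : ∀ l, coef b l (P.root (weylGroup.ofIdx P (j : ι) • β)) ≤ coef b l (v - μ))
    (hj : ¬ ∃ w : P.weylGroup, w • i = j)
    (hd : coef b j (v - μ) ≤ coef b j (P.root β) - 1) : False := by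
  have hcoef := coef_reflection b j j (P.root β)
  rw [coef_root_self, ← root_smul, mul_one] at hcoef
  have hij : 0 < coef b j (P.root i) := by
    have := (isPos_iff_coef_nonneg b _).mp hβ' j
    linarith [hle j]
  obtain ⟨y, ⟨u, hu⟩, hy, hyle, hynp, hypos⟩ := exists_minimal_conj b hi hij
  obtain ⟨w, hw⟩ := hconj
  have hlen : P.RootForm (P.root y) (P.root y) = P.RootForm (P.root i) (P.root i) := by
    rw [← hu, rootForm_root_smul]
  have hyj : y ≠ j := fun h => hj ⟨u, hu.trans h⟩
  have hnconj : ¬ ∃ w : P.weylGroup, w • y = j := by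
    rintro ⟨w', hw'⟩
    exact hj ⟨w' * u, by rw [mul_smul, hu, hw']⟩
  -- `L` and `n` are the squared lengths of `α` and `α_j`, and `t = ⟨β, α_j^∨⟩`, `t' = ⟨y, α_j^∨⟩`
  set L := P.RootForm (P.root i) (P.root i) with hL
  set n := P.RootForm (P.root (j : ι)) (P.root (j : ι)) with hn
  set t := P.coroot' (j : ι) (P.root β) with ht
  set t' := P.coroot' (j : ι) (P.root y) with ht'
  set β₀ := weylGroup.ofIdx P (j : ι) • β with hβ₀
  have hL0 : 0 < L := rootForm_root_pos P i
  have hn0 : 0 < n := rootForm_root_pos P (j : ι)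
  -- upper bound for the form of `γ = v - μ` and `y`, from `γ = β₀ + d` with `d ≥ 0`
  have hd1 : P.RootForm (P.root y) (v - μ - P.root β₀) ≤
      coef b j (v - μ - P.root β₀) * P.RootForm (P.root y) (P.root (j : ι)) := by
    classical
    rw [rootForm_eq_sum_coef b, ← Finset.add_sum_erase _ _ (Finset.mem_univ j)]
    have : ∑ m ∈ Finset.univ.erase j,
        coef b m (v - μ - P.root β₀) * P.RootForm (P.root y) (P.root (m : ι)) ≤ 0 := by
      refine Finset.sum_nonpos fun m hm => mul_nonpos_of_nonneg_of_nonpos ?_ ?_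
      · rw [map_sub]
        linarith [ih m]
      · have h2 := two_mul_rootForm P (m : ι) (P.root y)
        have h3 := mul_nonpos_of_nonpos_of_nonneg (hynp m (Finset.ne_of_mem_erase hm))
          (rootForm_root_pos P (m : ι)).le
        linarith
    linarith
  have hyjB : 2 * P.RootForm (P.root y) (P.root (j : ι)) = t' * n := two_mul_rootForm P _ _
  have hdj : coef b j (v - μ - P.root β₀) ≤ t - 1 := by
    rw [map_sub]
    linarith
  have hd2 : 2 * P.RootForm (P.root y) (v - μ - P.root β₀) ≤ (t - 1) * (t' * n) := by
    have h0 : 0 ≤ t' * n := by positivity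
    have := mul_le_mul_of_nonneg_right hdj h0
    rw [← hyjB] at this ⊢
    linarith
  have hβ₀y : 2 * P.RootForm (P.root y) (P.root β₀) ≤ 2 * L - t * t' * n := by
    -- both `β₀` and `s_j y` are conjugate to `α`
    have hz : P.RootForm (P.root β₀) (P.root (weylGroup.ofIdx P (j : ι) • y)) ≤ L := by
      have := rootForm_le_of_conj (P := P) (i := i) (j := weylGroup.ofIdx P (j : ι) • y)
        ⟨weylGroup.ofIdx P (j : ι) * u, by rw [mul_smul, hu]⟩ (weylGroup.ofIdx P (j : ι) * w)
      rwa [mul_smul, hw] at this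
    rw [root_smul P _ y, ofIdx_smul_eq, ← ht', map_sub, LinearMap.map_smul, smul_eq_mul] at hz
    have h1 := two_mul_rootForm P (j : ι) (P.root β₀)
    rw [hβ₀, root_smul, coroot'_ofIdx_smul_self, ← root_smul, ← hβ₀, ← ht, ← hn] at h1
    have h2 : t' * (2 * P.RootForm (P.root β₀) (P.root (j : ι))) = t' * (-t * n) := by rw [h1]
    rw [rootForm_comm]
    linarith
  have hupper : 2 * P.RootForm (P.root y) (v - μ) ≤ 2 * L - t' * n := by
    have : P.RootForm (P.root y) (v - μ) =
        P.RootForm (P.root y) (v - μ - P.root β₀) + P.RootForm (P.root y) (P.root β₀) := by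
      rw [← map_add, sub_add_cancel]
    rw [this]
    linarith
  -- lower bound for the same quantity, from the coordinates of `v` and `μ`
  set c := P.coroot' (j : ι) v with hc
  have hkc : (k j : ℝ) ≤ c := hv j
  have hc0 : 0 ≤ c := (Nat.cast_nonneg _).trans hkc
  have hky : k y = k i := by rw [← hu, hk]
  have hyt : t' ≤ coef b j (P.root y) := by
    have h1 := (isPos_iff_coef_nonneg b _).mp (isPos_smul_simple b hy j.2 hyj) j
    rw [root_smul, coef_reflection, coef_root_self, mul_one] at h1
    linarith
  have hv1 := le_two_mul_rootForm b hk hv hy hnconj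
  rw [hky, hlen] at hv1
  have hv2 : t' * (c * n) ≤ coef b j (P.root y) * (c * n) :=
    mul_le_mul_of_nonneg_right hyt (by positivity)
  have hμ1 : 2 * P.RootForm μ (P.root y) ≤ (k i - 1) * L := by
    rw [two_mul_rootForm, hlen]
    exact mul_le_mul_of_nonneg_right
      ((coroot'_le_coroot'_of_coef_le b hμ ⟨u, hu⟩ hyle).trans hlt) hL0.le
  have hmain : t' * n * (1 + c) ≤ L := by
    have h1 : P.RootForm (P.root y) (v - μ) =
        P.RootForm v (P.root y) - P.RootForm μ (P.root y) := by
      rw [map_sub, rootForm_comm P _ v, rootForm_comm P _ μ]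
    rw [h1] at hupper
    have h2 : t' * n * (1 + c) = t' * n + t' * (c * n) := by ring
    linarith
  -- `s = ⟨α_j, y^∨⟩` is a positive integer with `s L = t' n`
  have hs : P.coroot' y (P.root (j : ι)) * L = t' * n := by
    rw [← hyjB, rootForm_comm, two_mul_rootForm, hlen]
  rw [coroot'_root_eq_intCast] at hs
  have hs1 : 1 ≤ P.pairingIn ℤ (j : ι) y := by
    by_contra! h
    have h' : (P.pairingIn ℤ (j : ι) y : ℝ) ≤ 0 := by exact_mod_cast (by omega)
    have := mul_nonpos_of_nonpos_of_nonneg h' hL0.le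
    have : 0 < t' * n := by positivity
    linarith
  have hs1' : (1 : ℝ) ≤ P.pairingIn ℤ (j : ι) y := by exact_mod_cast hs1
  have hLt : L ≤ t' * n := by
    rw [← hs]
    exact le_mul_of_one_le_left hL0.le hs1'
  have hc1 : c ≤ 0 := by
    by_contra! hcp
    have : 0 < t' * n * c := by positivity
    linarith
  have hLt' : t' * n = L := by
    refine le_antisymm ?_ hLt
    have : 0 ≤ t' * n * c := by positivity
    linarith
  have hkj : k j = 0 := by
    have : (k j : ℝ) ≤ 0 := hkc.trans hc1
    exact Nat.le_zero.mp (by exact_mod_cast this)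
  have hki : k i = 0 := by
    refine eq_zero_of_length_lt b hk hgood (j := (j : ι)) ?_ hkj
    rw [← hL, ← hn, ← hLt']
    have ht'e : t' = (P.pairingIn ℤ y j : ℝ) := coroot'_root_eq_intCast P y j
    have ht1 : (1 : ℤ) ≤ P.pairingIn ℤ y j := by
      have : (0 : ℝ) < (P.pairingIn ℤ y j : ℝ) := ht'e ▸ hypos
      have : 0 < P.pairingIn ℤ y j := by exact_mod_cast this
      omega
    rcases ht1.eq_or_lt with h | h
    · -- `t' = 1` would give `α_j` the length of `y`, making the two roots conjugate
      exfalso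
      have ht1 : t' = 1 := by rw [ht'e, ← h, Int.cast_one]
      rw [ht1, one_mul] at hLt'
      exact hnconj (exists_smul_eq_of_length_eq (by rw [hlen, ← hn, hLt']))
    · have : (2 : ℝ) ≤ t' := by
        rw [ht'e]
        exact_mod_cast h
      have := mul_le_mul_of_nonneg_right this hn0.le
      linarith
  have := coroot'_nonneg_of_dominant b hμ hi
  rw [hki, Nat.cast_zero] at hlt
  linarith

/-- If `⟨μ, α^∨⟩ < k(α)` then `μ + α ≤ v`. The conjugates `β ≤ α` of `α` are built up from a simple
root by reflections in simple roots, and each of these steps stays below `v - μ`. -/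
lemma coef_root_le_coef_sub [P.IsIrreducible] {k : ι → ℕ} (hk : IsWeylInvariant P k)
    (hgood : IsGood b k) {v μ : M}
    (hv : ∀ l : b.support, (k l : ℝ) ≤ P.coroot' (l : ι) v) (hμ : μ ∈ dominantCone b)
    (hQ : v - μ ∈ P.rootSpan ℤ) (h0 : ∀ l, coef b l μ ≤ coef b l v)
    {i : ι} (hi : b.IsPos i) (hlt : P.coroot' i μ ≤ k i - 1) (l : b.support) :
    coef b l (P.root i) ≤ coef b l (v - μ) := by
  have hint : ∀ (β : ι) (m : b.support), coef b m (v - μ) < coef b m (P.root β) →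
      coef b m (v - μ) ≤ coef b m (P.root β) - 1 := by
    intro β m h
    obtain ⟨p, hp⟩ := exists_int_coef b hQ m
    obtain ⟨q, hq⟩ := exists_int_coef_root b β m
    rw [hp, hq] at h ⊢
    have : p < q := by exact_mod_cast h
    have : p ≤ q - 1 := by omega
    exact_mod_cast this
  have hnn : ∀ m, 0 ≤ coef b m (v - μ) := fun m => by rw [map_sub]; linarith [h0 m]
  refine isPos_induction b (p := fun β => (∃ w : P.weylGroup, w • i = β) →
    (∀ l, coef b l (P.root β) ≤ coef b l (P.root i)) →
    ∀ l, coef b l (P.root β) ≤ coef b l (v - μ)) ?_ ?_ i hi ⟨1, one_smul _ _⟩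
    (fun _ => le_rfl) l
  · rintro j hj hle m
    by_cases hjm : j = m
    · subst hjm
      by_contra! hcon
      have h1 := hint _ _ hcon
      have h2 := coroot'_le_two_mul_coef b (l := j) (x := v - μ) fun m _ => hnn m
      have h3 := coroot'_le_coroot'_of_coef_le b hμ hj hle
      have h4 := hv j
      obtain ⟨u, hu⟩ := hj
      rw [← hu, hk, hu] at h4
      rw [map_sub] at h2
      rw [coef_root_self] at h1
      linarith
    · rw [coef_root_of_ne b hjm]
      exact hnn m
  · rintro β j hβ hβ' hpos ih hconj hle m
    have hcoef : ∀ m, coef b m (P.root (weylGroup.ofIdx P (j : ι) • β)) = coef b m (P.root β) -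
        P.coroot' (j : ι) (P.root β) * coef b m (P.root (j : ι)) := fun m => by
      rw [root_smul, coef_reflection]
    have ih' := ih (by
        obtain ⟨w, hw⟩ := hconj
        exact ⟨weylGroup.ofIdx P (j : ι) * w, by rw [mul_smul, hw]⟩) (fun m => by
      rw [hcoef]
      have := mul_nonneg hpos.le ((isPos_iff_coef_nonneg b _).mp (b.isPos_of_mem_support j.2) m)
      linarith [hle m])
    by_cases hjm : j = m
    · subst hjm
      by_contra! hcon
      have hd := hint _ _ hcon
      by_cases hj : ∃ w : P.weylGroup, w • i = j
      · exact coef_le_of_conj hk hv hμ hlt hβ hβ' hpos hconj hle ih' hj hd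
      · exact coef_le_of_not_conj hk hgood hv hμ hi hlt hβ' hpos hconj hle ih' hj hd
    · have := ih' m
      rwa [hcoef, coef_root_of_ne b hjm, mul_zero, sub_zero] at this

end Compare

/-! ### Adding a root inside a permutohedron -/

section Escape
variable [Fintype ι] {P : RootPairing ι ℝ M N} [P.IsRootSystem] [P.IsCrystallographic]
  [P.IsReduced] (b : P.Base)

variable (P) in
lemma rootSpan_le_weightLattice {x : M} (hx : x ∈ P.rootSpan ℤ) : x ∈ weightLattice P := by
  induction hx using Submodule.span_induction with
  | mem x hx =>
    obtain ⟨i, rfl⟩ := hx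
    exact fun j => ⟨_, coroot'_root_eq_intCast P i j⟩
  | zero => exact zero_mem _
  | add x y _ _ hx hy => exact add_mem hx hy
  | smul a x _ hx => exact zsmul_mem hx a

variable (P) in
lemma smul_mem_weightLattice {v : M} (hv : v ∈ weightLattice P) (w : P.weylGroup) :
    w • v ∈ weightLattice P := by
  intro i
  obtain ⟨n, hn⟩ := hv (w⁻¹ • i)
  refine ⟨n, ?_⟩
  rw [← hn, coroot'_smul_left, inv_inv]

/-- The Weyl group acts trivially on weights modulo the root lattice. -/
lemma sub_smul_mem_rootSpan (b : P.Base) {v : M} (hv : v ∈ weightLattice P) (w : P.weylGroup) :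
    v - w • v ∈ P.rootSpan ℤ := by
  obtain ⟨l, rfl⟩ := exists_wordProd_eq b w
  induction l with
  | nil => simp [wordProd_nil]
  | cons i l ih =>
    obtain ⟨n, hn⟩ := smul_mem_weightLattice P hv (wordProd b l) (i : ι)
    rw [wordProd_cons, mul_smul, ofIdx_smul_eq, hn, Int.cast_smul_eq_zsmul,
      ← sub_add]
    exact add_mem ih (zsmul_mem (root_mem_rootSpan (i : ι)) n)

/-- A root pairs to at least `-1` with the coroots of all roots which are at least as long, its own
negative excepted. -/
lemma neg_one_le_coroot'_of_length_le {i j : ι}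
    (hl : P.RootForm (P.root i) (P.root i) ≤ P.RootForm (P.root j) (P.root j))
    (hne : P.root i ≠ -P.root j) : -1 ≤ P.coroot' j (P.root i) := by
  by_cases hij : P.root i = P.root j
  · rw [hij, P.root_coroot'_eq_pairing, P.pairing_same]
    norm_num
  have hmem := P.pairingIn_pairingIn_mem_set_of_isCrystal_of_isRed' i j hij hne
  have h1 := two_mul_rootForm P j (P.root i)
  have h2 := two_mul_rootForm P i (P.root j)
  rw [rootForm_comm] at h2
  rw [coroot'_root_eq_intCast] at h1 h2 ⊢
  have hj := rootForm_root_pos P j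
  simp only [Set.mem_insert_iff, Set.mem_singleton_iff, Prod.mk.injEq] at hmem
  rcases hmem with h | h | h | h | h | h | h | h | h | h | h <;> rw [h.1] at h1 ⊢ <;>
    rw [h.2] at h2 <;> push_cast at h1 h2 ⊢ <;> linarith

lemma coroot'_le_zero_of_lt_one {v : M} (hv : v ∈ weightLattice P) {i : ι}
    (h : P.coroot' i v < 1) : P.coroot' i v ≤ 0 := by
  obtain ⟨n, hn⟩ := hv i
  rw [hn] at h ⊢
  have : n < 1 := by exact_mod_cast h
  exact_mod_cast (by omega : n ≤ 0)

lemma one_le_coef_of_pos {x : M} (hx : x ∈ P.rootSpan ℤ) {l : b.support} (h : 0 < coef b l x) :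
    1 ≤ coef b l x := by
  obtain ⟨n, hn⟩ := exists_int_coef b hx l
  rw [hn] at h ⊢
  exact_mod_cast h

/-- If `α` is a root of minimal length and `μ` is dominant, then passing from `μ + α` to its
dominant conjugate adds one simple root at a time, and does not lead out of the vectors below
`v`. -/
lemma add_root_mem_saturation_of_short {v μ : M} (hv : v ∈ dominantCone b)
    (hμ : μ ∈ dominantCone b) (hμw : μ ∈ weightLattice P) (hQ : v - μ ∈ P.rootSpan ℤ) {i : ι}
    (hi : b.IsPos i) (hshort : ∀ l : b.support,
      P.RootForm (P.root i) (P.root i) ≤ P.RootForm (P.root (l : ι)) (P.root (l : ι)))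
    (hle : ∀ l, coef b l (P.root i) ≤ coef b l (v - μ)) :
    μ + P.root i ∈ saturation b v := by
  obtain ⟨n, hn⟩ := exists_nat_gt (∑ l, coef b l (v - μ - P.root i))
  induction n generalizing i with
  | zero =>
    refine absurd hn (not_lt.mpr ?_)
    rw [Nat.cast_zero]
    exact Finset.sum_nonneg fun l _ => by rw [map_sub]; linarith [hle l]
  | succ n ih =>
    by_cases hdom : μ + P.root i ∈ dominantCone b
    · refine mem_saturation_of_dominant b hdom fun l => ?_
      have := hle l
      rw [map_sub] at this
      rw [map_add]
      linarith
    · obtain ⟨j, hj, hneg⟩ : ∃ j ∈ b.support, P.coroot' j (μ + P.root i) < 0 := by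
        by_contra! h
        exact hdom h
      have hnej : P.root i ≠ -P.root j := by
        intro h
        have h1 := (isPos_iff_coef_nonneg b i).mp hi ⟨j, hj⟩
        have h2 := coef_root_self b ⟨j, hj⟩
        rw [h, map_neg] at h1
        simp only at h2
        linarith
      have hp := neg_one_le_coroot'_of_length_le (hshort ⟨j, hj⟩) hnej
      have hμj := hμ j hj
      rw [map_add] at hneg
      have hμj0 : P.coroot' j μ = 0 :=
        le_antisymm (coroot'_le_zero_of_lt_one hμw (by linarith)) hμj
      have hpj : P.coroot' j (P.root i) = -1 := by
        rw [coroot'_root_eq_intCast] at hp hneg ⊢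
        rw [hμj0, zero_add] at hneg
        have h1 : -1 ≤ P.pairingIn ℤ i j := by exact_mod_cast hp
        have h2 : P.pairingIn ℤ i j < 0 := by exact_mod_cast hneg
        exact_mod_cast (by omega : P.pairingIn ℤ i j = -1)
      have hij : i ≠ j := by
        rintro rfl
        rw [P.root_coroot'_eq_pairing, P.pairing_same] at hpj
        norm_num at hpj
      have hroot : P.root (weylGroup.ofIdx P j • i) = P.root i + P.root j := by
        rw [root_smul, ofIdx_smul_eq, hpj, neg_smul, one_smul, sub_neg_eq_add]
      have hsmul : weylGroup.ofIdx P j • (μ + P.root i) =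
          μ + P.root (weylGroup.ofIdx P j • i) := by
        rw [smul_add, ← root_smul, ofIdx_smul_eq P j μ, hμj0, zero_smul, sub_zero]
      -- the coordinate of `v - μ - α` at `α_j` is positive, and hence so is its coefficient
      have hcj : 1 ≤ coef b ⟨j, hj⟩ (v - μ - P.root i) := by
        refine one_le_coef_of_pos b (sub_mem hQ (root_mem_rootSpan i)) ?_
        have h1 := coroot'_le_two_mul_coef b (l := ⟨j, hj⟩) (x := v - μ - P.root i)
          fun m _ => by rw [map_sub]; linarith [hle m]
        simp only [map_sub] at h1 ⊢
        have := hv j hj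
        linarith
      have hle' : ∀ l, coef b l (P.root (weylGroup.ofIdx P j • i)) ≤ coef b l (v - μ) := by
        intro l
        rw [hroot, map_add]
        by_cases hl : (⟨j, hj⟩ : b.support) = l
        · have h2 := coef_root_self b ⟨j, hj⟩
          simp only at h2
          rw [← hl, h2]
          rw [map_sub] at hcj
          linarith
        · have h2 := coef_root_of_ne b hl
          simp only at h2
          rw [h2, add_zero]
          exact hle l
      have hsum : ∑ l, coef b l (v - μ - P.root (weylGroup.ofIdx P j • i)) =
          ∑ l, coef b l (v - μ - P.root i) - 1 := by
        have h1 := height_eq_sum_coef b j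
        rw [b.height_one_of_mem_support hj, Int.cast_one] at h1
        rw [h1, ← Finset.sum_sub_distrib]
        refine Finset.sum_congr rfl fun l _ => ?_
        rw [hroot, ← map_sub, sub_sub, sub_sub, sub_sub]
      rw [← smul_mem_saturation_iff b (weylGroup.ofIdx P j), hsmul]
      refine ih (isPos_smul_simple b hi hj hij) (fun l => ?_) hle' ?_
      · rw [rootForm_root_smul]
        exact hshort l
      · push_cast at hn
        linarith

/-- For an arbitrary root `α` the same holds, provided that `α` is dominant for the stabilizer of
`μ`: the first step towards the dominant conjugate of `μ + α` replaces a long root `α` by the short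
root `α + pα_j` inside an `α_j`-string. -/
lemma add_root_mem_saturation_of_le [P.IsIrreducible] {k : ι → ℕ} (hk : IsWeylInvariant P k)
    (hgood : IsGood b k) {v μ : M}
    (hv : ∀ l : b.support, (k l : ℝ) ≤ P.coroot' (l : ι) v)
    (hμ : μ ∈ dominantCone b) (hμw : μ ∈ weightLattice P) (hQ : v - μ ∈ P.rootSpan ℤ) {i : ι}
    (hi : b.IsPos i) (hki : k i ≠ 0)
    (hstab : ∀ l : b.support, P.coroot' (l : ι) μ = 0 → 0 ≤ P.coroot' (l : ι) (P.root i))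
    (hle : ∀ l, coef b l (P.root i) ≤ coef b l (v - μ)) :
    μ + P.root i ∈ saturation b v := by
  by_cases hdom : μ + P.root i ∈ dominantCone b
  · refine mem_saturation_of_dominant b hdom fun l => ?_
    have := hle l
    rw [map_sub] at this
    rw [map_add]
    linarith
  obtain ⟨j, hj, hneg⟩ : ∃ j ∈ b.support, P.coroot' j (μ + P.root i) < 0 := by
    by_contra! h
    exact hdom h
  rw [map_add] at hneg
  obtain ⟨m, hm⟩ := hμw j
  have hμj := hμ j hj
  have hpair := coroot'_root_eq_intCast P i j
  have hm1 : 1 ≤ m := by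
    by_contra! hm0
    have hm0' : m = 0 := by
      rw [hm] at hμj
      have : 0 ≤ m := by exact_mod_cast hμj
      omega
    have := hstab ⟨j, hj⟩ (by rw [hm, hm0', Int.cast_zero])
    rw [hm, hm0', Int.cast_zero, zero_add] at hneg
    simp only at this
    linarith
  have hsum : m + P.pairingIn ℤ i j < 0 := by
    rw [hm, hpair] at hneg
    exact_mod_cast hneg
  have hnep : P.root i ≠ P.root j := by
    intro h
    rw [P.root.injective h, P.pairingIn_same] at hsum
    omega
  have hnej : P.root i ≠ -P.root j := by
    intro h
    have h1 := (isPos_iff_coef_nonneg b i).mp hi ⟨j, hj⟩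
    have h2 := coef_root_self b ⟨j, hj⟩
    rw [h, map_neg] at h1
    simp only at h2
    linarith
  have hmem := P.pairingIn_pairingIn_mem_set_of_isCrystal_of_isRed' i j hnep hnej
  simp only [Set.mem_insert_iff, Set.mem_singleton_iff, Prod.mk.injEq] at hmem
  -- `⟨α, α_j^∨⟩ ≤ -2` leaves only `⟨α_j, α^∨⟩ = -1`, and `α` is longer than `α_j`
  have hji : P.pairingIn ℤ j i = -1 := by omega
  have hn0 := rootForm_root_pos P j
  have h1 := two_mul_rootForm P j (P.root i)
  have h2 := two_mul_rootForm P i (P.root j)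
  rw [coroot'_root_eq_intCast] at h1 h2
  rw [hji, rootForm_comm] at h2
  push_cast at h2
  have hlt : P.RootForm (P.root j) (P.root j) < P.RootForm (P.root i) (P.root i) := by
    have h3 : (P.pairingIn ℤ i j : ℝ) ≤ -2 := by exact_mod_cast (by omega)
    have := mul_le_mul_of_nonneg_right h3 hn0.le
    linarith
  have hkj : 1 ≤ P.coroot' j v := by
    have h3 : k j ≠ 0 := fun h => hki (eq_zero_of_length_lt b hk hgood hlt h)
    have h4 : (1 : ℝ) ≤ k j := by exact_mod_cast Nat.one_le_iff_ne_zero.mpr h3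
    exact h4.trans (hv ⟨j, hj⟩)
  obtain ⟨a, ha⟩ := P.root_add_root_mem_of_pairingIn_neg (by omega) hnej
  have halen : P.RootForm (P.root a) (P.root a) = P.RootForm (P.root j) (P.root j) := by
    rw [ha]
    simp only [map_add, LinearMap.add_apply]
    rw [rootForm_comm P (P.root j) (P.root i)]
    linarith
  -- `p` is the number with `s_j (μ + α) = μ + α + p α_j`
  obtain ⟨β, p, hp, hβ, hβlen, hp1, hp2⟩ : ∃ (β : ι) (p : ℤ), p = -(m + P.pairingIn ℤ i j) ∧
      P.root β = P.root i + (p : ℝ) • P.root j ∧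
      P.RootForm (P.root β) (P.root β) = P.RootForm (P.root j) (P.root j) ∧ 1 ≤ p ∧ p ≤ 2 := by
    rcases (by omega : m + P.pairingIn ℤ i j = -1 ∨
      (m + P.pairingIn ℤ i j = -2 ∧ P.pairingIn ℤ i j = -3)) with h | ⟨h, h'⟩
    · exact ⟨a, 1, by omega, by rw [ha, Int.cast_one, one_smul], halen, le_rfl, by norm_num⟩
    · refine ⟨weylGroup.ofIdx P j • a, 2, by omega, ?_, by rw [rootForm_root_smul, halen],
        by norm_num, le_rfl⟩
      rw [root_smul, ofIdx_smul_eq, ha, map_add, hpair, h', P.root_coroot'_eq_pairing,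
        P.pairing_same]
      push_cast
      module
  have hsmul : weylGroup.ofIdx P j • (μ + P.root i) = μ + P.root β := by
    rw [ofIdx_smul_eq, map_add, hm, hpair, hβ, hp]
    push_cast
    module
  have hpR : (1 : ℝ) ≤ p := by exact_mod_cast hp1
  have hβpos : b.IsPos β := by
    rw [isPos_iff_coef_nonneg]
    intro l
    rw [hβ, map_add, map_smul, smul_eq_mul]
    have h3 := (isPos_iff_coef_nonneg b i).mp hi l
    have h4 := (isPos_iff_coef_nonneg b j).mp (b.isPos_of_mem_support hj) l
    have := mul_nonneg (zero_le_one.trans hpR) h4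
    linarith
  rw [← smul_mem_saturation_iff b (weylGroup.ofIdx P j), hsmul]
  refine add_root_mem_saturation_of_short b (mem_dominantCone_of_le b hv) hμ hμw hQ hβpos
    (fun l => ?_) fun l => ?_
  · rw [hβlen]
    rcases RootPairing.InvariantForm.apply_eq_or_of_apply_ne P.toInvariantForm hlt.ne (l : ι)
      with h | h
    · exact h.ge
    · exact hlt.le.trans h.ge
  · rw [hβ, map_add, map_smul, smul_eq_mul]
    by_cases hl : (⟨j, hj⟩ : b.support) = l
    · have h3 := coef_root_self b ⟨j, hj⟩
      simp only at h3
      rw [← hl, h3, mul_one]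
      obtain ⟨c, hc⟩ := exists_int_coef b (sub_mem hQ (root_mem_rootSpan i)) ⟨j, hj⟩
      have h4 := coroot'_le_two_mul_coef b (l := ⟨j, hj⟩) (x := v - μ - P.root i)
        fun m _ => by rw [map_sub]; linarith [hle m]
      rw [hc, map_sub, map_sub] at h4
      simp only [hm, hpair] at h4
      have h5 : (p : ℝ) = -(m + P.pairingIn ℤ i j) := by exact_mod_cast hp
      -- `c ≥ p` follows by integrality since `p` is `1` or `2`;
      -- for `p = 2` it needs `⟨v, α_j^∨⟩ ≥ 1`
      have h6 : (1 : ℝ) + p ≤ 2 * c := by linarith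
      have h7 : 1 + p ≤ 2 * c := by exact_mod_cast h6
      have h8 : (p : ℝ) ≤ c := by exact_mod_cast (by omega : p ≤ c)
      rw [map_sub] at hc
      linarith
    · have h3 := coef_root_of_ne b hl
      simp only at h3
      rw [h3, mul_zero, add_zero]
      exact hle l

/-- The permutohedron of `v` is left in the direction of a root `α` only from points `μ` with
`⟨μ, α^∨⟩ ≥ k(α)`, when `k` is good and `⟨v, α_j^∨⟩ ≥ k(α_j)` for all simple roots `α_j`. -/
theorem add_root_mem_saturation [P.IsIrreducible] {k : ι → ℕ} (hk : IsWeylInvariant P k)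
    (hgood : IsGood b k) {v μ : M} (hvw : v ∈ weightLattice P)
    (hv : ∀ l : b.support, (k l : ℝ) ≤ P.coroot' (l : ι) v)
    (hμ : μ ∈ saturation b v) (hQ : v - μ ∈ P.rootSpan ℤ) {i : ι}
    (hlt : P.coroot' i μ ≤ k i - 1) :
    μ + P.root i ∈ saturation b v := by
  have hμw : μ ∈ weightLattice P := by
    have := sub_mem hvw (rootSpan_le_weightLattice P hQ)
    rwa [sub_sub_cancel] at this
  rcases lt_or_ge (P.coroot' i μ) 0 with hneg | hnn
  · -- `μ + α` lies on the segment from `μ` to `s_α μ`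
    obtain ⟨n, hn⟩ := hμw i
    rw [hn] at hneg
    have hn0 : n ≤ -1 := by
      have : n < 0 := by exact_mod_cast hneg
      omega
    have hn1 : (n : ℝ) ≤ -1 := by exact_mod_cast hn0
    have hs := (smul_mem_saturation_iff b (weylGroup.ofIdx P i) v μ).mpr hμ
    have hinv : 0 ≤ -(n : ℝ)⁻¹ := by
      rw [← inv_neg]
      exact inv_nonneg.mpr (by linarith)
    have hinv1 : -(n : ℝ)⁻¹ ≤ 1 := by
      rw [← inv_neg]
      exact inv_le_one_of_one_le₀ (by linarith)
    have hconv := convex_saturation b v hμ hs (sub_nonneg.mpr hinv1) hinv (sub_add_cancel _ _)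
    rw [ofIdx_smul_eq, hn] at hconv
    convert! hconv using 1
    have : (n : ℝ)⁻¹ * n = 1 := inv_mul_cancel₀ (by linarith)
    rw [smul_sub, smul_smul, neg_mul, this]
    module
  · have hki : k i ≠ 0 := by
      intro h
      rw [h, Nat.cast_zero] at hlt
      linarith
    have := finite_weylGroup P
    -- make `μ` dominant, and `α` as high as possible under that constraint
    obtain ⟨w, hw, hmax⟩ := Set.exists_max_image {w : P.weylGroup | w • μ ∈ dominantCone b}
      (fun w => b.height (w • i)) (Set.toFinite _) (by
        obtain ⟨u, hu⟩ := exists_dominant b μ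
        exact ⟨u⁻¹, hu⟩)
    have hpair : P.coroot' (w • i) (w • μ) = P.coroot' i μ := coroot'_smul_smul P w i μ
    have hpos : b.IsPos (w • i) := by
      by_contra hnp
      have hnp' := (isPos_reflection_self_iff b (w • i)).mpr hnp
      have h0 : P.coroot' (w • i) (w • μ) = 0 := by
        refine le_antisymm ?_ (hpair ▸ hnn)
        have h1 := coroot'_nonneg_of_dominant b hw hnp'
        rw [coroot'_smul_left, ofIdx_inv, coroot'_ofIdx_smul_self] at h1
        linarith
      have h1 := hmax (weylGroup.ofIdx P (w • i) * w) (by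
        change _ • μ ∈ dominantCone b
        rw [mul_smul, ofIdx_smul_eq, h0, zero_smul, sub_zero]
        exact hw)
      rw [mul_smul] at h1
      exact hnp (lt_of_lt_of_le hnp' h1)
    have hstab : ∀ l : b.support, P.coroot' (l : ι) (w • μ) = 0 →
        0 ≤ P.coroot' (l : ι) (P.root (w • i)) := by
      intro l hl
      have h1 := hmax (weylGroup.ofIdx P (l : ι) * w) (by
        change _ • μ ∈ dominantCone b
        rw [mul_smul, ofIdx_smul_eq, hl, zero_smul, sub_zero]
        exact hw)
      rw [mul_smul] at h1
      have h2 : (b.height (weylGroup.ofIdx P (l : ι) • w • i) : ℝ) ≤ b.height (w • i) := by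
        exact_mod_cast h1
      rw [height_reflection] at h2
      linarith
    have hQ' : v - w • μ ∈ P.rootSpan ℤ := by
      have := add_mem hQ (sub_smul_mem_rootSpan b hμw w)
      rwa [sub_add_sub_cancel] at this
    have hle := coef_root_le_coef_sub hk hgood hv hw hQ' (hμ w) hpos (by rwa [hpair, hk])
    have := add_root_mem_saturation_of_le b hk hgood hv hw (smul_mem_weightLattice P hμw w) hQ'
      hpos (by rwa [hk]) hstab hle
    rwa [root_smul, ← smul_add, smul_mem_saturation_iff] at this

end Escape

/-! ### Parabolic permutohedra are faces -/

section Parabolic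
variable [Fintype ι] {P : RootPairing ι ℝ M N} [P.IsRootSystem] [P.IsCrystallographic]
  [P.IsReduced] (b : P.Base)

lemma coef_parabolic_smul {I : Set ι} (hI : I ⊆ b.support) {p : P.weylGroup}
    (hp : p ∈ parabolic P I) {l : b.support} (hl : (l : ι) ∉ I) (x : M) :
    coef b l (p • x) = coef b l x := by
  induction hp using Subgroup.closure_induction generalizing x with
  | mem p hp =>
    obtain ⟨i, hi, rfl⟩ := hp
    have hil : (⟨i, hI hi⟩ : b.support) ≠ l := fun h => hl (h ▸ hi)
    have h := coef_reflection b ⟨i, hI hi⟩ l x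
    rwa [coef_root_of_ne b hil, mul_zero, sub_zero] at h
  | one => rw [one_smul]
  | mul p q _ _ hp hq => rw [mul_smul, hp, hq]
  | inv p _ hp => rw [← hp (p⁻¹ • x), smul_inv_smul]

lemma coef_eq_of_mem_parabolicPermutohedron {I : Set ι} (hI : I ⊆ b.support) {v x : M}
    (hx : x ∈ parabolicPermutohedron P I v) {l : b.support} (hl : (l : ι) ∉ I) :
    coef b l x = coef b l v := by
  have hconv : Convex ℝ {y : M | coef b l y = coef b l v} :=
    convex_hyperplane (coef b l).isLinear _
  refine convexHull_min ?_ hconv hx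
  rintro _ ⟨p, rfl⟩
  exact coef_parabolic_smul b hI p.2 hl v

variable (P) in
lemma parabolicPermutohedron_subset (I : Set ι) (v : M) :
    parabolicPermutohedron P I v ⊆ permutohedron P v := by
  refine convexHull_mono ?_
  rintro _ ⟨p, rfl⟩
  exact ⟨p, rfl⟩

/-- A conjugate of a dominant vector `v` which differs from `v` only by simple roots in `I` is
conjugate to `v` under `W_I`: its `W_I`-conjugate of greatest height is dominant. -/
lemma exists_parabolic_smul_eq {I : Set ι} (hI : I ⊆ b.support) {v : M} (hv : v ∈ dominantCone b)
    {u : P.weylGroup} (hu : ∀ l : b.support, (l : ι) ∉ I → coef b l (u • v) = coef b l v) :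
    ∃ p ∈ parabolic P I, u • v = p • v := by
  have := finite_weylGroup P
  obtain ⟨p, hp, hmax⟩ := Set.exists_max_image (parabolic P I : Set P.weylGroup)
    (fun p => ∑ l, coef b l (p • u • v)) (Set.toFinite _) ⟨1, one_mem _⟩
  have hdom : (p * u) • v ∈ dominantCone b := by
    rw [mul_smul]
    intro j hj
    by_cases hjI : j ∈ I
    · have h1 := hmax (weylGroup.ofIdx P j * p)
        (mul_mem (Subgroup.subset_closure ⟨j, hjI, rfl⟩) hp)
      have h2 := height_eq_sum_coef b j
      rw [b.height_one_of_mem_support hj, Int.cast_one] at h2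
      simp only [mul_smul, ofIdx_smul_eq P j, map_sub, LinearMap.map_smul, smul_eq_mul,
        Finset.sum_sub_distrib, ← Finset.mul_sum, ← h2, mul_one] at h1
      linarith
    · have h1 := coroot'_le_two_mul_coef b (l := ⟨j, hj⟩) (x := v - p • u • v) fun m _ => by
        rw [map_sub, ← mul_smul]
        linarith [coef_smul_le b hv (p * u) m]
      have h2 : coef b ⟨j, hj⟩ (v - p • u • v) = 0 := by
        rw [map_sub, coef_parabolic_smul b hI hp hjI, hu _ hjI, sub_self]
      rw [h2, mul_zero, map_sub] at h1
      linarith [hv j hj]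
  have h := eq_of_dominant_of_dominant b hv hdom
  refine ⟨p⁻¹, inv_mem hp, ?_⟩
  rw [eq_inv_smul_iff, ← mul_smul, h]

/-- The parabolic permutohedron is the face of the permutohedron where the coefficients outside
`I` are the greatest possible. -/
lemma mem_parabolicPermutohedron {I : Set ι} (hI : I ⊆ b.support) {v x : M}
    (hv : v ∈ dominantCone b) (hx : x ∈ permutohedron P v)
    (hxI : ∀ l : b.support, (l : ι) ∉ I → coef b l x = coef b l v) :
    x ∈ parabolicPermutohedron P I v := by
  classical
  obtain ⟨κ, _, c, z, hc0, hc1, hz, rfl⟩ := mem_convexHull_iff_exists_fintype.mp hx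
  have hzI : ∀ i, c i ≠ 0 → ∀ l : b.support, (l : ι) ∉ I → coef b l (z i) = coef b l v := by
    intro i hci l hl
    have hle : ∀ a, 0 ≤ c a * (coef b l v - coef b l (z a)) := by
      intro a
      obtain ⟨w, hw⟩ := hz a
      refine mul_nonneg (hc0 a) (sub_nonneg.mpr ?_)
      rw [← hw]
      exact coef_smul_le b hv w l
    have hsum : ∑ a, c a * (coef b l v - coef b l (z a)) = 0 := by
      have h := hxI l hl
      simp only [map_sum, LinearMap.map_smul, smul_eq_mul] at h
      simp only [mul_sub, Finset.sum_sub_distrib, ← Finset.sum_mul, hc1, one_mul, h, sub_self]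
    have h0 := (Finset.sum_eq_zero_iff_of_nonneg fun a _ => hle a).mp hsum i (Finset.mem_univ i)
    linarith [(mul_eq_zero.mp h0).resolve_left hci]
  have hmem : ∀ i, (if c i = 0 then v else z i) ∈ MulAction.orbit (parabolic P I) v := by
    intro i
    split_ifs with h
    · exact MulAction.mem_orbit_self v
    · obtain ⟨u, hu⟩ := hz i
      have hu' : u • v = z i := hu
      obtain ⟨p, hp, hpv⟩ := exists_parabolic_smul_eq b hI hv (u := u) (fun l hl => by
        rw [hu', hzI i h l hl])
      exact ⟨⟨p, hp⟩, by rw [← hu', hpv]; rfl⟩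
  -- the points of weight zero need not lie on the face and are replaced by `v`
  have hsum : ∑ i, c i • z i = ∑ i, c i • (if c i = 0 then v else z i) := by
    refine Finset.sum_congr rfl fun i _ => ?_
    split_ifs with h
    · rw [h, zero_smul, zero_smul]
    · rfl
  rw [hsum]
  exact (convex_convexHull ℝ _).sum_mem (fun i _ => hc0 i) hc1
    fun i _ => subset_convexHull ℝ _ (hmem i)

end Parabolic

/-! ### The weights `ρ_k` and `η_k(v)` -/

section Eta
variable [Fintype ι] {P : RootPairing ι ℝ M N} [P.IsRootSystem] [P.IsCrystallographic]
  [P.IsReduced] (b : P.Base) (k : ι → ℕ)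

lemma mem_weightLattice_of_simple {x : M}
    (h : ∀ l : b.support, ∃ n : ℤ, P.coroot' (l : ι) x = n) : x ∈ weightLattice P := by
  intro i
  have key : ∀ y ∈ Submodule.span ℤ (P.coroot '' b.support), ∃ n : ℤ, P.toLinearMap x y = n := by
    intro y hy
    induction hy using Submodule.span_induction with
    | mem y hy =>
      obtain ⟨j, hj, rfl⟩ := hy
      exact h ⟨j, hj⟩
    | zero => exact ⟨0, by simp⟩
    | add y z _ _ hy hz =>
      obtain ⟨m, hm⟩ := hy
      obtain ⟨n, hn⟩ := hz
      exact ⟨m + n, by rw [map_add, hm, hn]; push_cast; rfl⟩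
    | smul a y _ hy =>
      obtain ⟨m, hm⟩ := hy
      exact ⟨a * m, by rw [map_zsmul, hm, zsmul_eq_mul]; push_cast; rfl⟩
  exact key _ (b.coroot_mem_span_int i)

lemma coroot'_rhoK (l : b.support) : P.coroot' (l : ι) (rhoK b k) = k l := by
  classical
  rw [rhoK, map_sum]
  simp only [LinearMap.map_smul, coroot'_fundamentalWeight, smul_eq_mul, mul_ite, mul_one,
    mul_zero, Finset.sum_ite_eq, Finset.mem_univ, if_true]

lemma rhoK_mem_weightLattice : rhoK b k ∈ weightLattice P :=
  mem_weightLattice_of_simple b fun l => ⟨k l, by rw [coroot'_rhoK]; push_cast; rfl⟩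

lemma eta_of_dominant {v : M} (hv : v ∈ dominantCone b) : eta b k v = v + rhoK b k := by
  rw [eta, minElt_of_dominant b hv, one_smul]

lemma eta_eq_smul (v : M) : eta b k v = minElt b v • eta b k (dom b v) := by
  rw [eta_of_dominant b k (dom_mem_dominantCone b v), smul_add, minElt_smul_dom, eta]

lemma le_coroot'_eta {v : M} (hv : v ∈ dominantCone b) (l : b.support) :
    (k l : ℝ) ≤ P.coroot' (l : ι) (eta b k v) := by
  rw [eta_of_dominant b k hv, map_add, coroot'_rhoK]
  linarith [hv l l.2]

variable {k}

/-- A dominant weight with coordinate at least `2` at a simple root pairs to at least `2` with the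
coroots of all positive roots whose support contains that simple root. -/
lemma two_le_coroot' {v : M} (hv : v ∈ dominantCone b) {l : b.support}
    (hl : 2 ≤ P.coroot' (l : ι) v) {i : ι} (hi : b.IsPos i) (hil : 0 < coef b l (P.root i)) :
    2 ≤ P.coroot' i v := by
  classical
  set f := fundamentalWeight b l with hf
  have hfl : ∀ m : b.support, P.coroot' (m : ι) f = if m = l then 1 else 0 :=
    fun m => coroot'_fundamentalWeight b l m
  have hfw : f ∈ weightLattice P := mem_weightLattice_of_simple b fun m => by
    rw [hfl]
    split_ifs
    · exact ⟨1, by simp⟩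
    · exact ⟨0, by simp⟩
  have hfd : f ∈ dominantCone b := fun m hm => by
    rw [hfl ⟨m, hm⟩]
    split_ifs <;> simp
  have hvd : v - (2 : ℝ) • f ∈ dominantCone b := fun m hm => by
    have h1 := hfl ⟨m, hm⟩
    simp only at h1
    rw [map_sub, LinearMap.map_smul, h1, smul_eq_mul]
    split_ifs with h
    · rw [← h] at hl
      linarith
    · linarith [hv m hm]
  have h1 := coroot'_nonneg_of_dominant b hvd hi
  rw [map_sub, LinearMap.map_smul, smul_eq_mul] at h1
  have hpos : 0 < P.coroot' i f := by
    rw [coroot'_eq_div]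
    refine div_pos (mul_pos two_pos ?_) (rootForm_root_pos P i)
    rw [rootForm_eq_sum_coef b]
    refine lt_of_lt_of_le (mul_pos hil ?_) (Finset.single_le_sum (fun m _ =>
      mul_nonneg ((isPos_iff_coef_nonneg b i).mp hi m) (rootForm_simple_nonneg b hfd m))
      (Finset.mem_univ l))
    have h2 := two_mul_rootForm P (l : ι) f
    rw [hfl, if_pos rfl, one_mul] at h2
    linarith [rootForm_root_pos P (l : ι)]
  have h2 : 1 ≤ P.coroot' i f := by
    by_contra! h
    exact absurd hpos (not_lt.mpr (coroot'_le_zero_of_lt_one hfw h))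
  linarith

end Eta

/-! ### Firing moves -/

section Fire
variable [Fintype ι] {P : RootPairing ι ℝ M N} [P.IsRootSystem] [P.IsCrystallographic]
  [P.IsReduced] (b : P.Base) {k : ι → ℕ}

variable (P) in
lemma coroot'_neg_idx (i : ι) (x : M) :
    P.coroot' (weylGroup.ofIdx P i • i) x = -P.coroot' i x := by
  rw [coroot'_smul_left, ofIdx_inv, coroot'_ofIdx_smul_self]

variable {b} in
/-- Up to the sign of the root, firing moves and their inverses are given by the same
inequalities. -/
lemma exists_root_of_edge (hk : IsWeylInvariant P k) {μ μ' : M}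
    (h : SymFire b k μ μ' ∨ SymFire b k μ' μ) :
    ∃ i, μ' = μ + P.root i ∧ -(k i : ℝ) ≤ P.coroot' i μ + 1 ∧ P.coroot' i μ + 1 ≤ k i := by
  have hhalf : ∀ (i : ι) (x : M),
      P.coroot' i (x + (1 / 2 : ℝ) • P.root i) = P.coroot' i x + 1 := by
    intro i x
    rw [map_add, LinearMap.map_smul, P.root_coroot'_eq_pairing, P.pairing_same, smul_eq_mul]
    norm_num
  rcases h with ⟨-, i, -, rfl, hi⟩ | ⟨-, i, -, rfl, hi⟩
  · rw [hhalf] at hi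
    exact ⟨i, rfl, hi.1, hi.2⟩
  · rw [hhalf] at hi
    refine ⟨weylGroup.ofIdx P i • i, by rw [root_reflection_smul_self, add_neg_cancel_right], ?_⟩
    rw [coroot'_neg_idx, hk, map_add, P.root_coroot'_eq_pairing, P.pairing_same]
    constructor <;> linarith [hi.1, hi.2]

lemma add_root_mem_discretePermutohedron [P.IsIrreducible] (hk : IsWeylInvariant P k)
    (hgood : IsGood b k) {v : M} (hv : v ∈ dominantWeights b) {x : M}
    (hx : x ∈ discretePermutohedron P (eta b k v)) {i : ι} (hi : P.coroot' i x + 1 ≤ k i) :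
    x + P.root i ∈ discretePermutohedron P (eta b k v) := by
  have hle := le_coroot'_eta b k hv.2
  have hperm := permutohedron_eq_saturation b (mem_dominantCone_of_le b hle)
  have hw : eta b k v ∈ weightLattice P := by
    rw [eta_of_dominant b k hv.2]
    exact add_mem hv.1 (rhoK_mem_weightLattice b k)
  obtain ⟨hx1, hx2⟩ := hx
  rw [hperm] at hx1
  refine ⟨?_, ?_⟩
  · rw [hperm]
    refine add_root_mem_saturation b hk hgood hw hle hx1 ?_ (by linarith)
    rw [← neg_sub]
    exact neg_mem hx2
  · rw [add_sub_right_comm]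
    exact add_mem hx2 (root_mem_rootSpan i)

lemma zeroOneSet_subset (v : M) : zeroOneSet b v ⊆ b.support := fun _ hi => hi.1

/-- The roots outside the parabolic subsystem of `I^{0,1}` are too far from the firing interval
to give moves on the parabolic permutohedron. -/
lemma le_coroot'_of_mem_parabolicPermutohedron (hk : IsWeylInvariant P k) {v : M}
    (hv : v ∈ weightLattice P) {x : M}
    (hx : x ∈ parabolicPermutohedron P (zeroOneSet b v) (eta b k (dom b v))) {l : b.support}
    (hl : (l : ι) ∉ zeroOneSet b v) {i : ι} (hil : 0 < coef b l (P.root i)) :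
    (k i : ℝ) + 2 ≤ P.coroot' i x := by
  have hd := dom_mem_dominantCone b v
  have hdl : 2 ≤ P.coroot' (l : ι) (dom b v) := by
    obtain ⟨n, hn⟩ := smul_mem_weightLattice P hv (minElt b v)⁻¹ (l : ι)
    change P.coroot' (l : ι) (dom b v) = n at hn
    have h0 := hd l l.2
    have h1 : ¬ (P.coroot' (l : ι) (dom b v) = 0 ∨ P.coroot' (l : ι) (dom b v) = 1) :=
      fun h => hl ⟨l.2, h⟩
    rw [hn] at h0 h1 ⊢
    have h0' : 0 ≤ n := by exact_mod_cast h0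
    have h1' : ¬ (n = 0 ∨ n = 1) := by exact_mod_cast h1
    exact_mod_cast (by omega : 2 ≤ n)
  refine convexHull_min (t := {y | (k i : ℝ) + 2 ≤ P.coroot' i y}) ?_
    (convex_halfSpace_ge (P.coroot' i).isLinear _) hx
  rintro _ ⟨⟨p, hp⟩, rfl⟩
  change (k i : ℝ) + 2 ≤ P.coroot' i (p • eta b k (dom b v))
  have hcoef : 0 < coef b l (P.root (p⁻¹ • i)) := by
    rw [root_smul, coef_parabolic_smul b (zeroOneSet_subset b v) (inv_mem hp) hl]
    exact hil
  have hpos := isPos_of_coef_pos b hcoef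
  have h1 := two_le_coroot' b hd hdl hpos hcoef
  have h2 := le_coroot'_of_isPos b hk (fun l => (coroot'_rhoK b k l).ge) hpos
  have h3 := coroot'_smul_left P p⁻¹ i (eta b k (dom b v))
  rw [inv_inv] at h3
  rw [hk] at h2
  rw [← h3, eta_of_dominant b k hd, map_add]
  linarith

lemma add_root_mem_discreteParabolicPermutohedron [P.IsIrreducible] (hk : IsWeylInvariant P k)
    (hgood : IsGood b k) {v : M} (hv : v ∈ weightLattice P) {x : M}
    (hx : x ∈ discreteParabolicPermutohedron P (zeroOneSet b v) (eta b k (dom b v))) {i : ι}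
    (hi : -(k i : ℝ) ≤ P.coroot' i x + 1) (hi' : P.coroot' i x + 1 ≤ k i) :
    x + P.root i ∈ discreteParabolicPermutohedron P (zeroOneSet b v) (eta b k (dom b v)) := by
  have hd := dom_mem_dominantCone b v
  have hdw : dom b v ∈ dominantWeights b := ⟨smul_mem_weightLattice P hv _, hd⟩
  have hI := zeroOneSet_subset b v
  have hroot : ∀ l : b.support, (l : ι) ∉ zeroOneSet b v → coef b l (P.root i) = 0 := by
    intro l hl
    rcases lt_trichotomy (coef b l (P.root i)) 0 with h | h | h
    · have h1 := le_coroot'_of_mem_parabolicPermutohedron b hk hv hx.1 hl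
        (i := weylGroup.ofIdx P i • i) (by rw [root_reflection_smul_self, map_neg]; linarith)
      rw [coroot'_neg_idx, hk] at h1
      linarith
    · exact h
    · have h1 := le_coroot'_of_mem_parabolicPermutohedron b hk hv hx.1 hl h
      linarith
  obtain ⟨h1, h2⟩ := add_root_mem_discretePermutohedron b hk hgood hdw
    ⟨parabolicPermutohedron_subset P _ _ hx.1, hx.2⟩ hi'
  refine ⟨mem_parabolicPermutohedron b hI (mem_dominantCone_of_le b (le_coroot'_eta b k hd)) h1
    fun l hl => ?_, h2⟩
  rw [map_add, hroot l hl, add_zero, coef_eq_of_mem_parabolicPermutohedron b hI hx.1 hl]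

lemma not_symFire_eta (hk : IsWeylInvariant P k) {v : M} (hv : v ∈ weightLattice P)
    (hne : ∀ i, b.IsPos i → P.coroot' i v ≠ -1) (μ : M) : ¬ SymFire b k (eta b k v) μ := by
  rintro ⟨-, i, hi, -, hlo, hhi⟩
  rw [map_add, LinearMap.map_smul, P.root_coroot'_eq_pairing, P.pairing_same, smul_eq_mul,
    eta_eq_smul] at hlo hhi
  have hd := dom_mem_dominantCone b v
  set j := (minElt b v)⁻¹ • i with hj
  have hij : i = minElt b v • j := by rw [hj, smul_inv_smul]
  have h1 : P.coroot' i (minElt b v • eta b k (dom b v)) =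
      P.coroot' j (dom b v) + P.coroot' j (rhoK b k) := by
    rw [hij, coroot'_smul_smul, eta_of_dominant b k hd, map_add]
  have h2 : P.coroot' i v = P.coroot' j (dom b v) := by
    rw [hj, coroot'_smul_left, inv_inv, minElt_smul_dom]
  have hkj : k j = k i := hk _ _
  rw [h1, ← hkj] at hlo hhi
  by_cases hpos : b.IsPos j
  · have h3 := coroot'_nonneg_of_dominant b hd hpos
    have h4 := le_coroot'_of_isPos b hk (fun l => (coroot'_rhoK b k l).ge) hpos
    linarith
  · have hpos' := (isPos_reflection_self_iff b j).mpr hpos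
    have h3 := coroot'_nonneg_of_dominant b hd hpos'
    have h4 := le_coroot'_of_isPos b hk (fun l => (coroot'_rhoK b k l).ge) hpos'
    rw [coroot'_neg_idx] at h3 h4
    rw [hk] at h4
    have h5 : P.coroot' j (dom b v) ≠ 0 := by
      intro h0
      have h6 := isPos_minElt_smul b hpos' (by rw [coroot'_neg_idx, h0, neg_zero])
      obtain ⟨l, hl⟩ := exists_coef_pos b hi
      have h7 := (isPos_iff_coef_nonneg b _).mp h6 l
      rw [root_smul, root_reflection_smul_self, smul_neg, ← root_smul, ← hij, map_neg] at h7
      linarith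
    have h6 := hne i hi
    obtain ⟨n, hn⟩ := hv i
    rw [← h2, hn] at h3 h5 hlo hhi
    rw [hn] at h6
    have h3' : n ≤ 0 := by
      have : (n : ℝ) ≤ 0 := by linarith
      exact_mod_cast this
    have h5' : n ≠ 0 := by exact_mod_cast h5
    have h6' : n ≠ -1 := by exact_mod_cast h6
    have h7 : (n : ℝ) ≤ -2 := by exact_mod_cast (by omega : n ≤ -2)
    linarith

lemma component_eta_subset [P.IsIrreducible] (hk : IsWeylInvariant P k) (hgood : IsGood b k)
    {v : M} (hv : v ∈ weightLattice P) :
    component b k (eta b k v) ⊆ minElt b v •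
      discreteParabolicPermutohedron P (zeroOneSet b v) (eta b k (dom b v)) := by
  set K := minElt b v • discreteParabolicPermutohedron P (zeroOneSet b v) (eta b k (dom b v))
    with hK
  have hedge : ∀ μ μ' : M, (SymFire b k μ μ' ∨ SymFire b k μ' μ) → μ ∈ K → μ' ∈ K := by
    intro μ μ' h hμ
    obtain ⟨i, rfl, hi, hi'⟩ := exists_root_of_edge hk h
    rw [hK, Set.mem_smul_set_iff_inv_smul_mem] at hμ ⊢
    rw [smul_add, ← root_smul]
    have hc := coroot'_smul_smul P (minElt b v)⁻¹ i μ
    refine add_root_mem_discreteParabolicPermutohedron b hk hgood hv hμ ?_ ?_ <;>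
    · rw [hc, hk]
      assumption
  have hiff : ∀ μ ν : M, Relation.EqvGen (SymFire b k) μ ν → (μ ∈ K ↔ ν ∈ K) := by
    intro μ ν h
    induction h with
    | rel μ ν h => exact ⟨hedge μ ν (Or.inl h), hedge ν μ (Or.inr h)⟩
    | refl μ => exact Iff.rfl
    | symm μ ν _ h => exact h.symm
    | trans μ ν ξ _ _ h h' => exact h.trans h'
  rintro μ ⟨-, hμ⟩
  refine (hiff μ _ hμ).mpr ?_
  rw [eta_eq_smul]
  refine Set.smul_mem_smul_set ⟨subset_convexHull ℝ _ (MulAction.mem_orbit_self _), ?_⟩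
  rw [sub_self]
  exact zero_mem _

end Fire

end IntervalFiring

end

theorem mainTheorem6 {ι M N : Type*} [Fintype ι] [AddCommGroup M] [Module ℝ M]
    [AddCommGroup N] [Module ℝ N] (P : RootPairing ι ℝ M N) [P.IsRootSystem]
    [P.IsCrystallographic] [P.IsReduced] [P.IsIrreducible] (b : P.Base)
    (k : ι → ℕ) (hk : IntervalFiring.IsWeylInvariant P k) (hgood : IntervalFiring.IsGood b k) :
    (∀ v ∈ IntervalFiring.dominantWeights b, ∀ μ μ' : M,
      (IntervalFiring.SymFire b k μ μ' ∨ IntervalFiring.SymFire b k μ' μ) →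
      μ ∈ IntervalFiring.discretePermutohedron P (IntervalFiring.eta b k v) →
      μ' ∈ IntervalFiring.discretePermutohedron P (IntervalFiring.eta b k v)) ∧
    (∀ v ∈ IntervalFiring.weightLattice P, (∀ i, b.IsPos i → P.coroot' i v ≠ -1) →
      (∀ μ : M, ¬ IntervalFiring.SymFire b k (IntervalFiring.eta b k v) μ) ∧
      IntervalFiring.component b k (IntervalFiring.eta b k v) ⊆
        IntervalFiring.minElt b v •
          IntervalFiring.discreteParabolicPermutohedron P (IntervalFiring.zeroOneSet b v)
            (IntervalFiring.eta b k (IntervalFiring.dom b v))) := by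
  refine ⟨?_, ?_⟩
  · intro v hv μ μ' hedge hμ
    obtain ⟨i, rfl, -, hi⟩ := IntervalFiring.exists_root_of_edge hk hedge
    exact IntervalFiring.add_root_mem_discretePermutohedron b hk hgood hv hμ hi
  · intro v hv hne
    exact ⟨IntervalFiring.not_symFire_eta b hk hv hne,
      IntervalFiring.component_eta_subset b hk hgood hv⟩
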